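/- Call $\mathsf M=(M,d,\mu)$ a metric probability space if $(M,d)$ is a metric space and $\mu$ is a Borel probability measure on it. For a finite $K\ge 0$ and $0<\rho\le 1$, say that $\mathsf M$ has $(K,\rho)$-expansion if there is a finitely supported probability measure $\mathsf P$ on the set of measure-preserving bijections $\phi:M\to M$ such that (E1) $\operatorname{Lip}(\phi)\le K$ and $\operatorname{Lip}(\phi^{-1})\le K$ for every $\phi\in\operatorname{supp}\mathsf P$; and (E2) for every $n\ge 1$ and every complex-valued $f\in L^2(M^n,\mu^n)$ with $\int f\,d\mu^n=0$, the averaging operator $T_{\mathsf P}f(x_1,\dots,x_n)=\mathbb E_{\phi\sim\mathsf P}\bigl[f(\phi(x_1),\dots,\phi(x_n))\bigr]$ satisfies $\|T_{\mathsf P}f\|_2\le(1-\rho)\|f\|_2$. Say that $\mathsf M$ expands uniformly if it has $(K,\rho)$-expansion for some finite $K$ and some $0<\rho\le1$ (neither depending on $n$). Let $S^d\subset\mathbb R^{d+1}$ denote the round unit sphere with its geodesic metric $d(x,y)=\arccos\langle x,y\rangle$ and its normalised surface area measure. Proposition. Let $m\ge 3$. If $S^{m-1}$ expands uniformly, then so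 does $S^m$. -/

import Mathlib

open MeasureTheory
open scoped NNReal ENNReal

noncomputable section

/-! ### Uniform expansion of a metric probability space -/

/-- The measure-preserving bijections `φ : M → M` of a measure space `(M, μ)`. -/
abbrev MeasurePreservingBijection {M : Type*} [MeasurableSpace M] (μ : Measure M) : Type _ :=
  {φ : M ≃ M // MeasurePreserving φ μ μ}

/-- A finitely supported probability measure `P` on measure-preserving bijections, given by its
point masses. -/
def IsProbabilityWeight {α : Type*} (P : α →₀ ℝ) : Prop :=
  (∀ φ, 0 ≤ P φ) ∧ P.sum (fun _ w => w) = 1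

/-- The averaging operator
`T_P f (x₁, …, xₙ) = 𝔼_{φ ∼ P} [f (φ x₁, …, φ xₙ)]` (the same `φ` in every coordinate). -/
def averagingOperator {M : Type*} [MeasurableSpace M] {μ : Measure M}
    (P : MeasurePreservingBijection μ →₀ ℝ) {n : ℕ} (f : (Fin n → M) → ℂ) :
    (Fin n → M) → ℂ :=
  fun x => P.sum fun φ w => (w : ℂ) * f (fun i => φ.1 (x i))

/-- `(K, ρ)`-expansion of the metric probability space `(M, dist, μ)`.  An element of `L²₀(Mⁿ)` is
given by a complex-valued square-integrable function on `Mⁿ` with integral zero. -/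
def HasExpansion (M : Type*) [MetricSpace M] [MeasurableSpace M] [BorelSpace M]
    (μ : Measure M) [IsProbabilityMeasure μ] (K : ℝ≥0) (ρ : ℝ) : Prop :=
  ∃ P : MeasurePreservingBijection μ →₀ ℝ,
    IsProbabilityWeight P ∧
    (∀ φ ∈ P.support, LipschitzWith K φ.1 ∧ LipschitzWith K φ.1.symm) ∧
    ∀ n : ℕ, 1 ≤ n → ∀ f : (Fin n → M) → ℂ,
      MemLp f 2 (Measure.pi fun _ => μ) →
      ∫ x, f x ∂(Measure.pi fun _ => μ) = 0 →
      eLpNorm (averagingOperator P f) 2 (Measure.pi fun _ => μ) ≤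
        ENNReal.ofReal (1 - ρ) * eLpNorm f 2 (Measure.pi fun _ => μ)

/-- `(M, dist, μ)` expands uniformly: it has `(K, ρ)`-expansion for some finite `K` and some
`0 < ρ ≤ 1`; neither depends on the number `n` of points. -/
def ExpandsUniformly (M : Type*) [MetricSpace M] [MeasurableSpace M] [BorelSpace M]
    (μ : Measure M) [IsProbabilityMeasure μ] : Prop :=
  ∃ (K : ℝ≥0) (ρ : ℝ), 0 < ρ ∧ ρ ≤ 1 ∧ HasExpansion M μ K ρ

/-! ### The round sphere -/

/-- The unit sphere `S^d` in `ℝ^(d+1)`.  This is a type synonym because it carries the geodesic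
metric, whereas `Metric.sphere 0 1` carries the chordal one. -/
def RoundSphere (d : ℕ) : Type :=
  Metric.sphere (0 : EuclideanSpace ℝ (Fin (d + 1))) 1

namespace RoundSphere

/-- The inclusion `S^d ⊆ ℝ^(d+1)`. -/
def coords {d : ℕ} (x : RoundSphere d) : EuclideanSpace ℝ (Fin (d + 1)) :=
  Subtype.val (p := (· ∈ Metric.sphere (0 : EuclideanSpace ℝ (Fin (d + 1))) 1)) x

theorem norm_coords {d : ℕ} (x : RoundSphere d) : ‖x.coords‖ = 1 :=
  mem_sphere_zero_iff_norm.1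
    (Subtype.property (p := (· ∈ Metric.sphere (0 : EuclideanSpace ℝ (Fin (d + 1))) 1)) x)

theorem coords_ne_zero {d : ℕ} (x : RoundSphere d) : x.coords ≠ 0 := by
  intro h
  have := norm_coords x
  simp [h] at this

theorem coords_injective {d : ℕ} : Function.Injective (coords (d := d)) :=
  Subtype.val_injective

/-- The geodesic metric: the distance of two points is the angle between them, that is
`dist x y = arccos ⟪x, y⟫`. -/
instance instMetricSpace (d : ℕ) : MetricSpace (RoundSphere d) where
  dist x y := InnerProductGeometry.angle x.coords y.coords
  dist_self x := InnerProductGeometry.angle_self (coords_ne_zero x)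
  dist_comm x y := InnerProductGeometry.angle_comm _ _
  dist_triangle x y z := InnerProductGeometry.angle_le_angle_add_angle _ _ _
  eq_of_dist_eq_zero {x y} h := by
    apply coords_injective
    have h1 := InnerProductGeometry.norm_sub_eq_abs_sub_norm_of_angle_eq_zero h
    rw [norm_coords, norm_coords, sub_self, abs_zero, norm_eq_zero, sub_eq_zero] at h1
    exact h1

instance instMeasurableSpace (d : ℕ) : MeasurableSpace (RoundSphere d) :=
  inferInstanceAs
    (MeasurableSpace (Metric.sphere (0 : EuclideanSpace ℝ (Fin (d + 1))) 1))

theorem dist_eq_arccos {d : ℕ} (x y : RoundSphere d) :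
    dist x y = Real.arccos (inner ℝ x.coords y.coords) := by
  change InnerProductGeometry.angle _ _ = _
  simp [InnerProductGeometry.angle, norm_coords]

theorem norm_coords_sub_sq {d : ℕ} (x y : RoundSphere d) :
    ‖x.coords - y.coords‖ ^ 2 = 2 - 2 * Real.cos (dist x y) := by
  change _ = 2 - 2 * Real.cos (InnerProductGeometry.angle _ _)
  rw [@norm_sub_sq_real, InnerProductGeometry.cos_angle, norm_coords, norm_coords]
  ring

/-- The Borel sets of the geodesic metric are those induced from `ℝ^(d+1)`. -/
instance instBorelSpace (d : ℕ) : BorelSpace (RoundSphere d) := by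
  let ι : RoundSphere d → Metric.sphere (0 : EuclideanSpace ℝ (Fin (d + 1))) 1 := fun x => x
  have hι : ∀ x y, dist (ι x) (ι y) = ‖x.coords - y.coords‖ := fun x y =>
    (Subtype.dist_eq (ι x) (ι y)).trans (dist_eq_norm _ _)
  have hlip : LipschitzWith 1 ι := LipschitzWith.of_dist_le_mul fun x y => by
    rw [hι, NNReal.coe_one, one_mul]
    refine le_of_sq_le_sq ?_ dist_nonneg
    have := Real.one_sub_sq_div_two_le_cos (x := dist x y)
    rw [norm_coords_sub_sq]
    linarith
  have hanti : AntilipschitzWith (Real.toNNReal (Real.pi / 2)) ι :=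
    AntilipschitzWith.of_le_mul_dist fun x y => by
      rw [hι, Real.coe_toNNReal _ (by positivity)]
      have h0 : (0 : ℝ) ≤ dist x y := dist_nonneg
      have h1 : |dist x y| ≤ Real.pi := by
        rw [abs_of_nonneg h0]
        exact InnerProductGeometry.angle_le_pi _ _
      have h2 := Real.cos_le_one_sub_mul_cos_sq h1
      refine le_of_sq_le_sq ?_ (by positivity)
      rw [mul_pow, norm_coords_sub_sq]
      have hpi : (0 : ℝ) < Real.pi ^ 2 := by positivity
      have h3 : (Real.pi / 2) ^ 2 * (2 - 2 * (1 - 2 / Real.pi ^ 2 * dist x y ^ 2))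
          = dist x y ^ 2 := by
        field_simp
        ring
      rw [← h3]
      gcongr
  have hind : Topology.IsInducing ι :=
    (hanti.isUniformInducing hlip.uniformContinuous).isInducing
  constructor
  have h1 : borel (RoundSphere d) = MeasurableSpace.comap ι (borel _) :=
    (congrArg (fun t => @borel (RoundSphere d) t) hind.eq_induced).trans
      (borel_comap (f := ι))
  rw [h1, ← BorelSpace.measurable_eq]
  exact MeasurableSpace.comap_id.symm

/-- The surface area measure of the unit sphere `S^d`. -/
def areaMeasure (d : ℕ) : Measure (RoundSphere d) :=
  (volume : Measure (EuclideanSpace ℝ (Fin (d + 1)))).toSphere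

/-- The uniform probability measure on `S^d`: normalised surface area. -/
def uniformMeasure (d : ℕ) : Measure (RoundSphere d) :=
  (areaMeasure d Set.univ)⁻¹ • areaMeasure d

instance instIsProbabilityMeasure (d : ℕ) : IsProbabilityMeasure (uniformMeasure d) := by
  constructor
  have h0 : areaMeasure d Set.univ ≠ 0 := by
    rw [Ne, Measure.measure_univ_eq_zero]
    exact Measure.toSphere_ne_zero _
  have h1 : areaMeasure d Set.univ ≠ ∞ := by
    have : IsFiniteMeasure
      ((volume : Measure (EuclideanSpace ℝ (Fin (d + 1)))).toSphere) := inferInstance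
    exact this.measure_univ_lt_top.ne
  rw [uniformMeasure, Measure.smul_apply, smul_eq_mul, ENNReal.inv_mul_cancel h0 h1]

end RoundSphere

end

/-!
Write `x = (t, √(1 - t²) y)` with `t ∈ [-1, 1]` and `y` on the equator; for a uniform random point,
`t` and `y` are independent. Suspending the expanding maps of the equator, with `t` fixed, gives an
average `T` on `(S^m)^n` that contracts, for each value of `(t₁, …, tₙ)`, the variance in
`(y₁, …, yₙ)`. What `T` fails to contract is the conditional expectation `E f` of `f` given the
first coordinates of the points. Let `R` interchange the first two coordinates of every point; the
conjugate `R T R` fails to contract only the conditional expectation given the second coordinates,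
so `(T + R T R) / 2` contracts provided that functions of the first coordinates and functions of
the second coordinates are uniformly far from parallel.

Given its first coordinate `t`, the `k`-th moment of the second coordinate is
`(1 - t²)^(k/2) ∫ y₁^k`: zero for `k` odd, and for `k` even a polynomial in `t` of degree `k` with
leading coefficient `± ∫ y₁^k`, of modulus at most `∫ y₁² ≤ 1/2` once the equator has dimension at
least one. The conditional expectation is thus triangular on polynomials, and being self-adjoint up
to `R` it has norm at most `1/2` on functions of mean zero. This bound on the maximal correlation of
the two coordinates passes to products of independent copies, hence does not depend on `n`.
-/

section Fibration

open ProbabilityTheory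

variable {X Y : Type*} [MeasurableSpace X] [MeasurableSpace Y] {μ : Measure X} {ν : Measure Y}

theorem ae_memLp_two_fibre [SFinite μ] [SFinite ν] {F : X × Y → ℝ} (hF : MemLp F 2 (μ.prod ν)) :
    ∀ᵐ x ∂μ, MemLp (fun y ↦ F (x, y)) 2 ν := by
  filter_upwards [hF.1.prodMk_left, hF.integrable_sq.prod_right_ae] with x hmeas hint
  exact (memLp_two_iff_integrable_sq hmeas).2 hint

variable [IsProbabilityMeasure ν]

theorem sq_integral_le_integral_sq {f : Y → ℝ} (hf : MemLp f 2 ν) :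
    (∫ y, f y ∂ν) ^ 2 ≤ ∫ y, f y ^ 2 ∂ν := by
  have hvar := variance_nonneg f ν
  rw [variance_eq_sub hf] at hvar
  exact sub_nonneg.1 hvar

theorem memLp_two_integral_fibre [SFinite μ] {F : X × Y → ℝ} (hF : MemLp F 2 (μ.prod ν)) :
    MemLp (fun x ↦ ∫ y, F (x, y) ∂ν) 2 μ := by
  have hmeas : AEStronglyMeasurable (fun x ↦ ∫ y, F (x, y) ∂ν) μ := hF.1.integral_prod_right'
  refine (memLp_two_iff_integrable_sq hmeas).2
    (hF.integrable_sq.integral_prod_left.mono' (hmeas.pow 2) ?_)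
  filter_upwards [ae_memLp_two_fibre hF] with x hx
  exact (Real.norm_of_nonneg (sq_nonneg _)).trans_le (sq_integral_le_integral_sq hx)

theorem covariance_fibre_ae_eq [SFinite μ] {F G : X × Y → ℝ} (hF : MemLp F 2 (μ.prod ν))
    (hG : MemLp G 2 (μ.prod ν)) :
    (fun x ↦ cov[fun y ↦ F (x, y), fun y ↦ G (x, y); ν]) =ᵐ[μ]
      fun x ↦ ∫ y, F (x, y) * G (x, y) ∂ν - (∫ y, F (x, y) ∂ν) * ∫ y, G (x, y) ∂ν := by
  filter_upwards [ae_memLp_two_fibre hF, ae_memLp_two_fibre hG] with x hFx hGx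
  exact covariance_eq_sub hFx hGx

theorem integrable_covariance_fibre [SFinite μ] {F G : X × Y → ℝ} (hF : MemLp F 2 (μ.prod ν))
    (hG : MemLp G 2 (μ.prod ν)) :
    Integrable (fun x ↦ cov[fun y ↦ F (x, y), fun y ↦ G (x, y); ν]) μ :=
  ((hF.integrable_mul hG).integral_prod_left.sub
    ((memLp_two_integral_fibre hF).integrable_mul (memLp_two_integral_fibre hG))).congr
    (covariance_fibre_ae_eq hF hG).symm

theorem integrable_variance_fibre [SFinite μ] {F : X × Y → ℝ} (hF : MemLp F 2 (μ.prod ν)) :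
    Integrable (fun x ↦ Var[fun y ↦ F (x, y); ν]) μ := by
  refine (integrable_covariance_fibre hF hF).congr ?_
  filter_upwards [ae_memLp_two_fibre hF] with x hx
  exact covariance_self hx.1.aemeasurable

variable [IsProbabilityMeasure μ]

theorem covariance_prod {F G : X × Y → ℝ} (hF : MemLp F 2 (μ.prod ν))
    (hG : MemLp G 2 (μ.prod ν)) :
    cov[F, G; μ.prod ν] = ∫ x, cov[fun y ↦ F (x, y), fun y ↦ G (x, y); ν] ∂μ +
      cov[fun x ↦ ∫ y, F (x, y) ∂ν, fun x ↦ ∫ y, G (x, y) ∂ν; μ] := by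
  have hF' := memLp_two_integral_fibre hF
  have hG' := memLp_two_integral_fibre hG
  have hFG : Integrable (fun z ↦ F z * G z) (μ.prod ν) := hF.integrable_mul hG
  have hFG' : Integrable (fun x ↦ (∫ y, F (x, y) ∂ν) * ∫ y, G (x, y) ∂ν) μ :=
    hF'.integrable_mul hG'
  rw [integral_congr_ae (covariance_fibre_ae_eq hF hG), integral_sub hFG.integral_prod_left hFG',
    covariance_eq_sub hF hG, covariance_eq_sub hF' hG']
  simp only [Pi.mul_apply]
  rw [integral_prod _ hFG, integral_prod _ (hF.integrable one_le_two),
    integral_prod _ (hG.integrable one_le_two)]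
  ring

theorem variance_prod {F : X × Y → ℝ} (hF : MemLp F 2 (μ.prod ν)) :
    Var[F; μ.prod ν] = ∫ x, Var[fun y ↦ F (x, y); ν] ∂μ +
      Var[fun x ↦ ∫ y, F (x, y) ∂ν; μ] := by
  rw [← covariance_self hF.1.aemeasurable, covariance_prod hF hF,
    covariance_self (memLp_two_integral_fibre hF).1.aemeasurable]
  congr 1
  refine integral_congr_ae ?_
  filter_upwards [ae_memLp_two_fibre hF] with x hx
  exact covariance_self hx.1.aemeasurable

end Fibration

section CovarianceComp

open ProbabilityTheory

theorem covariance_comp_measurePreserving {Ω Ω' : Type*} [MeasurableSpace Ω] [MeasurableSpace Ω']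
    {μ : Measure Ω} {μ' : Measure Ω'} {X Y : Ω → ℝ} {e : Ω' → Ω} (he : MeasurePreserving e μ' μ)
    (hX : AEStronglyMeasurable X μ) (hY : AEStronglyMeasurable Y μ) :
    cov[X ∘ e, Y ∘ e; μ'] = cov[X, Y; μ] := by
  obtain ⟨he, rfl⟩ := he
  exact (covariance_map hX hY he.aemeasurable).symm

end CovarianceComp

section SqrtIntegral

variable {X : Type*} [MeasurableSpace X] {μ : Measure X} {f g : X → ℝ}

theorem memLp_two_sqrt (hf : Integrable f μ) (hf0 : 0 ≤ f) : MemLp (fun x ↦ √(f x)) 2 μ := by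
  refine (memLp_two_iff_integrable_sq
    (Real.continuous_sqrt.comp_aestronglyMeasurable hf.1)).2 (hf.congr (.of_forall fun x ↦ ?_))
  exact (Real.sq_sqrt (hf0 x)).symm

theorem integrable_sqrt_mul_sqrt (hf : Integrable f μ) (hf0 : 0 ≤ f) (hg : Integrable g μ)
    (hg0 : 0 ≤ g) : Integrable (fun x ↦ √(f x) * √(g x)) μ :=
  (memLp_two_sqrt hf hf0).integrable_mul (memLp_two_sqrt hg hg0)

theorem integral_sqrt_mul_sqrt_le (hf : Integrable f μ) (hf0 : 0 ≤ f) (hg : Integrable g μ)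
    (hg0 : 0 ≤ g) : ∫ x, √(f x) * √(g x) ∂μ ≤ √(∫ x, f x ∂μ) * √(∫ x, g x ∂μ) := by
  have holder := integral_mul_le_Lp_mul_Lq_of_nonneg Real.HolderConjugate.two_two
    (.of_forall fun x ↦ Real.sqrt_nonneg (f x)) (.of_forall fun x ↦ Real.sqrt_nonneg (g x))
    (by simpa using memLp_two_sqrt hf hf0) (by simpa using memLp_two_sqrt hg hg0)
  simpa only [Real.rpow_two, Real.sq_sqrt (hf0 _), Real.sq_sqrt (hg0 _), ← Real.sqrt_eq_rpow]
    using holder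

end SqrtIntegral

section MaximalCorrelation

open ProbabilityTheory

variable {Ω Ω' A B A' B' : Type*} [MeasurableSpace Ω] [MeasurableSpace Ω'] [MeasurableSpace A]
  [MeasurableSpace B] [MeasurableSpace A'] [MeasurableSpace B'] {μ : Measure Ω} {μ' : Measure Ω'}
  {a : Ω → A} {b : Ω → B} {a' : Ω' → A'} {b' : Ω' → B'} {c : ℝ}

/-- The (Hirschfeld–Gebelein–Rényi) maximal correlation of the random variables `a` and `b` is at
most `c`: any two square-integrable functions of `a` and of `b` have correlation at most `c`. -/
def MaxCorrLE (a : Ω → A) (b : Ω → B) (c : ℝ) (μ : Measure Ω) : Prop :=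
  ∀ (F : A → ℝ) (G : B → ℝ), MemLp F 2 (μ.map a) → MemLp G 2 (μ.map b) →
    |cov[F ∘ a, G ∘ b; μ]| ≤ c * (√Var[F ∘ a; μ] * √Var[G ∘ b; μ])

theorem sqrt_mul_sqrt_add_le {x y z w : ℝ} (hx : 0 ≤ x) (hy : 0 ≤ y) (hz : 0 ≤ z) (hw : 0 ≤ w) :
    √x * √y + √z * √w ≤ √(x + z) * √(y + w) := by
  simpa [Fin.sum_univ_two] using Real.sum_sqrt_mul_sqrt_le (f := ![x, z]) (g := ![y, w]) .univ
    (by simp [Fin.forall_fin_two, hx, hz]) (by simp [Fin.forall_fin_two, hy, hw])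

namespace MaxCorrLE

theorem of_centered [IsProbabilityMeasure μ] (ha : AEMeasurable a μ) (hb : AEMeasurable b μ)
    (h : ∀ (F : A → ℝ) (G : B → ℝ), MemLp F 2 (μ.map a) → MemLp G 2 (μ.map b) →
      μ[F ∘ a] = 0 → μ[G ∘ b] = 0 →
      |μ[(F ∘ a) * (G ∘ b)]| ≤ c * (√(∫ ω, F (a ω) ^ 2 ∂μ) * √(∫ ω, G (b ω) ^ 2 ∂μ))) :
    MaxCorrLE a b c μ := by
  have := Measure.isProbabilityMeasure_map ha
  have := Measure.isProbabilityMeasure_map hb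
  intro F G hF hG
  have hFa : MemLp (F ∘ a) 2 μ := hF.comp_of_map ha
  have hGb : MemLp (G ∘ b) 2 μ := hG.comp_of_map hb
  have hcentered := h (fun x ↦ F x - μ[F ∘ a]) (fun y ↦ G y - μ[G ∘ b])
    (hF.sub (memLp_const _)) (hG.sub (memLp_const _))
    (by simpa [average_eq_integral] using integral_sub_average μ (F ∘ a))
    (by simpa [average_eq_integral] using integral_sub_average μ (G ∘ b))
  rwa [variance_eq_integral hFa.1.aemeasurable, variance_eq_integral hGb.1.aemeasurable]

theorem postcomp {u : A → A'} {v : B → B'} (h : MaxCorrLE a b c μ) (ha : Measurable a)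
    (hb : Measurable b) (hu : Measurable u) (hv : Measurable v) :
    MaxCorrLE (u ∘ a) (v ∘ b) c μ := by
  intro F G hF hG
  rw [← Measure.map_map hu ha] at hF
  rw [← Measure.map_map hv hb] at hG
  exact h _ _ (hF.comp_of_map hu.aemeasurable) (hG.comp_of_map hv.aemeasurable)

theorem comp_measurePreserving {e : Ω' → Ω} (h : MaxCorrLE a b c μ) (ha : Measurable a)
    (hb : Measurable b) (he : MeasurePreserving e μ' μ) : MaxCorrLE (a ∘ e) (b ∘ e) c μ' := by
  intro F G hF hG
  rw [← Measure.map_map ha he.measurable, he.map_eq] at hF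
  rw [← Measure.map_map hb he.measurable, he.map_eq] at hG
  have hFa := hF.comp_of_map ha.aemeasurable
  have hGb := hG.comp_of_map hb.aemeasurable
  have hbound := h F G hF hG
  rwa [← covariance_comp_measurePreserving he hFa.1 hGb.1,
    ← he.variance_fun_comp hFa.1.aemeasurable, ← he.variance_fun_comp hGb.1.aemeasurable] at hbound

theorem abs_integral_covariance_fibre_le [IsProbabilityMeasure μ] [IsProbabilityMeasure μ']
    (hc : 0 ≤ c) (ha : Measurable a) (hb : Measurable b) (ha' : Measurable a')
    (hb' : Measurable b') (h' : MaxCorrLE a' b' c μ') {F : A × A' → ℝ} {G : B × B' → ℝ}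
    (hF : MemLp F 2 ((μ.map a).prod (μ'.map a'))) (hG : MemLp G 2 ((μ.map b).prod (μ'.map b'))) :
    |∫ ω, cov[fun ω' ↦ F (a ω, a' ω'), fun ω' ↦ G (b ω, b' ω'); μ'] ∂μ| ≤
      c * (√(∫ ω, Var[fun ω' ↦ F (a ω, a' ω'); μ'] ∂μ) *
        √(∫ ω, Var[fun ω' ↦ G (b ω, b' ω'); μ'] ∂μ)) := by
  have := Measure.isProbabilityMeasure_map ha'.aemeasurable (μ := μ')
  have := Measure.isProbabilityMeasure_map hb'.aemeasurable (μ := μ')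
  have hFa : MemLp (fun z : Ω × Ω' ↦ F (a z.1, a' z.2)) 2 (μ.prod μ') :=
    hF.comp_measurePreserving ((ha.measurePreserving μ).prod (ha'.measurePreserving μ'))
  have hGb : MemLp (fun z : Ω × Ω' ↦ G (b z.1, b' z.2)) 2 (μ.prod μ') :=
    hG.comp_measurePreserving ((hb.measurePreserving μ).prod (hb'.measurePreserving μ'))
  have hVF := integrable_variance_fibre hFa
  have hVG := integrable_variance_fibre hGb
  have hVF0 : 0 ≤ fun ω ↦ Var[fun ω' ↦ F (a ω, a' ω'); μ'] := fun _ ↦ variance_nonneg _ _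
  have hVG0 : 0 ≤ fun ω ↦ Var[fun ω' ↦ G (b ω, b' ω'); μ'] := fun _ ↦ variance_nonneg _ _
  calc _ ≤ ∫ ω, c * (√Var[fun ω' ↦ F (a ω, a' ω'); μ'] *
        √Var[fun ω' ↦ G (b ω, b' ω'); μ']) ∂μ := by
        refine abs_integral_le_integral_abs.trans (integral_mono_ae
          (integrable_covariance_fibre hFa hGb).abs
          ((integrable_sqrt_mul_sqrt hVF hVF0 hVG hVG0).const_mul c) ?_)
        filter_upwards [ae_of_ae_map ha.aemeasurable (ae_memLp_two_fibre hF),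
          ae_of_ae_map hb.aemeasurable (ae_memLp_two_fibre hG)] with ω hFω hGω
        exact h' _ _ hFω hGω
    _ ≤ _ := by
        rw [integral_const_mul]
        exact mul_le_mul_of_nonneg_left (integral_sqrt_mul_sqrt_le hVF hVF0 hVG hVG0) hc

theorem memLp_two_integral_fibre_map [IsFiniteMeasure μ] [IsProbabilityMeasure μ']
    (ha' : Measurable a') {F : A × A' → ℝ} (hF : MemLp F 2 ((μ.map a).prod (μ'.map a'))) :
    MemLp (fun x ↦ ∫ ω', F (x, a' ω') ∂μ') 2 (μ.map a) :=
  memLp_two_integral_fibre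
    (hF.comp_measurePreserving ((MeasurePreserving.id (μ.map a)).prod (ha'.measurePreserving μ')))

theorem prod [IsProbabilityMeasure μ] [IsProbabilityMeasure μ'] (hc : 0 ≤ c)
    (ha : Measurable a) (hb : Measurable b) (ha' : Measurable a') (hb' : Measurable b')
    (h : MaxCorrLE a b c μ) (h' : MaxCorrLE a' b' c μ') :
    MaxCorrLE (Prod.map a a') (Prod.map b b') c (μ.prod μ') := by
  intro F G hF hG
  have hFa : MemLp (F ∘ Prod.map a a') 2 (μ.prod μ') :=
    hF.comp_of_map (ha.prodMap ha').aemeasurable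
  have hGb : MemLp (G ∘ Prod.map b b') 2 (μ.prod μ') :=
    hG.comp_of_map (hb.prodMap hb').aemeasurable
  rw [← Measure.map_prod_map _ _ ha ha'] at hF
  rw [← Measure.map_prod_map _ _ hb hb'] at hG
  have hfibre := abs_integral_covariance_fibre_le hc ha hb ha' hb' h' hF hG
  have hmean := h _ _ (memLp_two_integral_fibre_map ha' hF) (memLp_two_integral_fibre_map hb' hG)
  rw [covariance_prod hFa hGb, variance_prod hFa, variance_prod hGb]
  calc _ ≤ _ := abs_add_le _ _
    _ ≤ _ := add_le_add hfibre hmean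
    _ = _ := (mul_add c _ _).symm
    _ ≤ _ := mul_le_mul_of_nonneg_left (sqrt_mul_sqrt_add_le
        (integral_nonneg fun _ ↦ variance_nonneg _ _) (integral_nonneg fun _ ↦ variance_nonneg _ _)
        (variance_nonneg _ _) (variance_nonneg _ _)) hc

theorem pi [IsProbabilityMeasure μ] (hc : 0 ≤ c) (ha : Measurable a) (hb : Measurable b)
    (h : MaxCorrLE a b c μ) (n : ℕ) :
    MaxCorrLE (fun (ω : Fin n → Ω) i ↦ a (ω i)) (fun ω i ↦ b (ω i)) c (.pi fun _ ↦ μ) := by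
  induction n with
  | zero =>
    intro F G _ _
    have hconst : (F ∘ fun (ω : Fin 0 → Ω) i ↦ a (ω i)) = fun _ ↦ F isEmptyElim :=
      funext fun ω ↦ congrArg F (Subsingleton.elim _ _)
    rw [hconst, covariance_const_left, abs_zero]
    positivity
  | succ n ih =>
    have hprod := h.prod hc ha hb (measurable_pi_lambda _ fun i ↦ ha.comp (measurable_pi_apply i))
      (measurable_pi_lambda _ fun i ↦ hb.comp (measurable_pi_apply i)) ih
    have hsplit := measurePreserving_piFinSuccAbove (fun _ : Fin (n + 1) ↦ μ) 0
    convert ((hprod.postcomp (by fun_prop) (by fun_prop)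
      (MeasurableEquiv.piFinSuccAbove (fun _ ↦ A) 0).symm.measurable
      (MeasurableEquiv.piFinSuccAbove (fun _ ↦ B) 0).symm.measurable).comp_measurePreserving
      (by fun_prop) (by fun_prop) hsplit) using 1
    · exact funext fun ω ↦ (MeasurableEquiv.eq_symm_apply _).2 rfl
    · exact funext fun ω ↦ (MeasurableEquiv.eq_symm_apply _).2 rfl

end MaxCorrLE

end MaximalCorrelation

section TriangularOperator

open InnerProductSpace Submodule Set

variable {𝕜 H ι : Type*} [RCLike 𝕜] [NormedAddCommGroup H] [InnerProductSpace 𝕜 H]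

theorem norm_sq_sum_of_pairwise_inner_eq_zero {e : ι → H}
    (he : Pairwise fun i j ↦ inner 𝕜 (e i) (e j) = 0) (s : Finset ι) :
    ‖∑ i ∈ s, e i‖ ^ 2 = ∑ i ∈ s, ‖e i‖ ^ 2 := by
  classical
  induction s using Finset.induction with
  | empty => simp
  | insert i s hi ih =>
    have horth : inner 𝕜 (e i) (∑ j ∈ s, e j) = 0 := by
      rw [inner_sum]
      exact Finset.sum_eq_zero fun j hj ↦ he (ne_of_mem_of_not_mem hj hi).symm
    rw [Finset.sum_insert hi, Finset.sum_insert hi, ← ih]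
    simpa only [sq] using norm_add_sq_eq_norm_sq_add_norm_sq_of_inner_eq_zero _ _ horth

theorem norm_map_le_of_mem_span_eigenvectors {S : H →ₗ[𝕜] H} {e : ι → H} {l : ι → 𝕜} {t : Set ι}
    {c : ℝ} (hc : 0 ≤ c) (he : Pairwise fun i j ↦ inner 𝕜 (e i) (e j) = 0)
    (hS : ∀ i, S (e i) = l i • e i) (hl : ∀ i ∈ t, ‖l i‖ ≤ c) {x : H} (hx : x ∈ span 𝕜 (e '' t)) :
    ‖S x‖ ≤ c * ‖x‖ := by
  obtain ⟨a, ha, rfl⟩ := (Finsupp.mem_span_image_iff_linearCombination 𝕜).1 hx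
  simp only [Finsupp.linearCombination_apply, Finsupp.sum, map_sum, map_smul, hS]
  have horth (m : ι → 𝕜) : Pairwise fun i j ↦ inner 𝕜 (m i • e i) (m j • e j) = 0 :=
    fun i j hij ↦ by simp [inner_smul_left, inner_smul_right, he hij]
  refine le_of_sq_le_sq ?_ (by positivity)
  calc ‖∑ i ∈ a.support, a i • l i • e i‖ ^ 2
      = ∑ i ∈ a.support, ‖l i • a i • e i‖ ^ 2 := by
        simp_rw [smul_comm (a _)]
        rw [← norm_sq_sum_of_pairwise_inner_eq_zero (𝕜 := 𝕜)]
        simpa only [smul_smul] using horth fun i ↦ l i * a i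
    _ ≤ ∑ i ∈ a.support, c ^ 2 * ‖a i • e i‖ ^ 2 := by
        refine Finset.sum_le_sum fun i hi ↦ ?_
        rw [norm_smul, mul_pow]
        gcongr
        exact hl i (ha hi)
    _ = (c * ‖∑ i ∈ a.support, a i • e i‖) ^ 2 := by
        rw [← Finset.mul_sum, mul_pow, norm_sq_sum_of_pairwise_inner_eq_zero (horth a)]

variable [LinearOrder ι] {S : H →ₗ[𝕜] H} {v : ι → H} {l : ι → 𝕜}

theorem map_mem_span_Iio_of_triangular
    (htri : ∀ k, S (v k) - l k • v k ∈ span 𝕜 (v '' Iio k)) (k : ι) {x : H}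
    (hx : x ∈ span 𝕜 (v '' Iio k)) : S x ∈ span 𝕜 (v '' Iio k) := by
  suffices h : span 𝕜 (v '' Iio k) ≤ (span 𝕜 (v '' Iio k)).comap S from h hx
  rw [span_le]
  rintro _ ⟨j, hj, rfl⟩
  rw [SetLike.mem_coe, mem_comap, ← sub_add_cancel (S (v j)) (l j • v j)]
  exact add_mem (span_mono (image_mono (Iio_subset_Iio (le_of_lt hj))) (htri j))
    (smul_mem _ _ (subset_span (mem_image_of_mem v hj)))

variable [LocallyFiniteOrder ι] [OrderBot ι] [WellFoundedLT ι]

theorem sub_gramSchmidt_mem_span_Iio (v : ι → H) (k : ι) :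
    v k - gramSchmidt 𝕜 v k ∈ span 𝕜 (v '' Iio k) := by
  rw [gramSchmidt_def, sub_sub_cancel, ← span_gramSchmidt_Iio 𝕜 v k]
  refine sum_mem fun j hj ↦ ?_
  have hmem : gramSchmidt 𝕜 v j ∈ span 𝕜 (gramSchmidt 𝕜 v '' Iio k) :=
    subset_span (mem_image_of_mem (gramSchmidt 𝕜 v) (Finset.mem_Iio.1 hj))
  exact (span_singleton_le_iff_mem _ _).2 hmem (starProjection_apply_mem _ (v k))

theorem map_gramSchmidt_of_triangular (hS : S.IsSymmetric)
    (htri : ∀ k, S (v k) - l k • v k ∈ span 𝕜 (v '' Iio k)) (k : ι) :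
    S (gramSchmidt 𝕜 v k) = l k • gramSchmidt 𝕜 v k := by
  set e := gramSchmidt 𝕜 v k
  set V := span 𝕜 (v '' Iio k) with hV
  have hmem : S e - l k • e ∈ V := by
    have hdiff := sub_gramSchmidt_mem_span_Iio (𝕜 := 𝕜) v k
    have := sub_mem (htri k) (sub_mem (map_mem_span_Iio_of_triangular htri k hdiff)
      (smul_mem _ (l k) hdiff))
    rw [map_sub, smul_sub] at this
    convert this using 1
    abel
  have horth : ∀ u ∈ V, inner 𝕜 u e = 0 := by
    rw [hV, ← span_gramSchmidt_Iio 𝕜 v k]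
    intro u hu
    induction hu using span_induction with
    | mem u hu =>
      obtain ⟨j, hj, rfl⟩ := hu
      exact gramSchmidt_orthogonal 𝕜 v (ne_of_lt hj)
    | zero => exact inner_zero_left _
    | add x y _ _ hx hy => rw [inner_add_left, hx, hy, add_zero]
    | smul a x _ hx => rw [inner_smul_left, hx, mul_zero]
  rw [← sub_eq_zero, ← inner_self_eq_zero (𝕜 := 𝕜)]
  set w := S e - l k • e
  rw [inner_sub_right w, ← hS, inner_smul_right, horth w hmem,
    horth _ (map_mem_span_Iio_of_triangular htri k hmem), mul_zero, sub_zero]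

theorem norm_map_le_of_triangular {S : H →L[𝕜] H} (hS : (S : H →ₗ[𝕜] H).IsSymmetric)
    (htri : ∀ k, S (v k) - l k • v k ∈ span 𝕜 (v '' Iio k))
    (hv : (span 𝕜 (range v)).topologicalClosure = ⊤) {c : ℝ} (hc : 0 ≤ c)
    (hl : ∀ k, k ≠ ⊥ → ‖l k‖ ≤ c) {x : H} (hx : inner 𝕜 (v ⊥) x = 0) : ‖S x‖ ≤ c * ‖x‖ := by
  let e : ι → H := gramSchmidt 𝕜 v
  have hbot : e ⊥ = v ⊥ := gramSchmidt_bot 𝕜 v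
  let Q : H →L[𝕜] H := (𝕜 ∙ e ⊥)ᗮ.starProjection
  have hQe (k : ι) (hk : k ≠ ⊥) : Q (e k) = e k := starProjection_eq_self_iff.2
    (mem_orthogonal_singleton_iff_inner_right.2 (gramSchmidt_orthogonal 𝕜 v hk.symm))
  have hQ : span 𝕜 (range e) ≤ (span 𝕜 (e '' {⊥}ᶜ)).comap (Q : H →ₗ[𝕜] H) := by
    rw [span_le]
    rintro _ ⟨k, rfl⟩
    by_cases hk : k = ⊥
    · have hQ0 : Q (e k) = 0 :=
        hk ▸ starProjection_orthogonalComplement_singleton_eq_zero (𝕜 := 𝕜) (e ⊥)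
      simp [hQ0]
    · have hQk : Q (e k) ∈ span 𝕜 (e '' {⊥}ᶜ) :=
        (hQe k hk).symm ▸ subset_span (mem_image_of_mem e hk)
      exact hQk
  have hbound : ∀ y, ‖S (Q y)‖ ≤ c * ‖Q y‖ := by
    refine fun y ↦ closure_minimal (s := (span 𝕜 (range e) : Set H))
      (t := {y | ‖S (Q y)‖ ≤ c * ‖Q y‖}) (fun y hy ↦ ?_)
      (isClosed_le (by fun_prop) (by fun_prop)) ?_
    · exact norm_map_le_of_mem_span_eigenvectors hc (gramSchmidt_pairwise_orthogonal 𝕜 v)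
        (map_gramSchmidt_of_triangular hS htri) hl (hQ hy)
    · rw [span_gramSchmidt, ← topologicalClosure_coe, hv]
      exact mem_top
  have hQx : Q x = x := starProjection_eq_self_iff.2
    (mem_orthogonal_singleton_iff_inner_right.2 (by rwa [hbot]))
  simpa only [hQx] using hbound x

end TriangularOperator

section ConditionalOperator

variable {Ω A B : Type*} [MeasurableSpace Ω] [MeasurableSpace A] [MeasurableSpace B]
  {μ : Measure Ω} {α : Measure A} {β : Measure B} {a : Ω → A} {b : Ω → B}

theorem integral_comp_of_measurePreserving {f : A → ℝ} (ha : MeasurePreserving a μ α)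
    (hf : AEStronglyMeasurable f α) : ∫ ω, f (a ω) ∂μ = ∫ x, f x ∂α := by
  rw [← ha.map_eq, integral_map ha.aemeasurable (ha.map_eq.symm ▸ hf)]

theorem inner_toLp_toLp {f g : A → ℝ} (hf : MemLp f 2 α) (hg : MemLp g 2 α) :
    inner ℝ hf.toLp hg.toLp = ∫ x, f x * g x ∂α := by
  rw [L2.inner_def]
  refine integral_congr_ae ?_
  filter_upwards [hf.coeFn_toLp, hg.coeFn_toLp] with x hfx hgx
  simp [hfx, hgx, mul_comm]

theorem norm_toLp_eq_sqrt {f : A → ℝ} (hf : MemLp f 2 α) : ‖hf.toLp‖ = √(∫ x, f x ^ 2 ∂α) := by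
  simp only [norm_eq_sqrt_real_inner, inner_toLp_toLp, sq]

/-- The operator `g ↦ 𝔼[g(b) | a = ·]` from `L²` of the law of `b` to `L²` of the law of `a`. -/
noncomputable def conditionalOperator (ha : MeasurePreserving a μ α)
    (hb : MeasurePreserving b μ β) : Lp ℝ 2 β →L[ℝ] Lp ℝ 2 α :=
  (Lp.compMeasurePreservingₗᵢ ℝ a ha).toContinuousLinearMap.adjoint ∘L
    (Lp.compMeasurePreservingₗᵢ ℝ b hb).toContinuousLinearMap

variable {ha : MeasurePreserving a μ α} {hb : MeasurePreserving b μ β}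

theorem inner_conditionalOperator (f : Lp ℝ 2 α) (g : Lp ℝ 2 β) :
    inner ℝ f (conditionalOperator ha hb g) =
      inner ℝ (Lp.compMeasurePreserving a ha f) (Lp.compMeasurePreserving b hb g) := by
  rw [conditionalOperator, ContinuousLinearMap.comp_apply, ContinuousLinearMap.adjoint_inner_right]
  rfl

theorem inner_conditionalOperator_toLp {f : A → ℝ} {g : B → ℝ} (hf : MemLp f 2 α)
    (hg : MemLp g 2 β) :
    inner ℝ hf.toLp (conditionalOperator ha hb hg.toLp) = ∫ ω, f (a ω) * g (b ω) ∂μ := by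
  rw [inner_conditionalOperator, Lp.toLp_compMeasurePreserving, Lp.toLp_compMeasurePreserving]
  exact inner_toLp_toLp _ _

theorem isSymmetric_conditionalOperator {b : Ω → A} {hb : MeasurePreserving b μ α} {R : Ω → Ω}
    (hR : MeasurePreserving R μ μ) (hRa : a ∘ R = b) (hRb : b ∘ R = a) :
    (conditionalOperator ha hb : Lp ℝ 2 α →ₗ[ℝ] Lp ℝ 2 α).IsSymmetric := by
  intro f g
  let U := Lp.compMeasurePreservingₗᵢ (E := ℝ) (p := 2) ℝ R hR
  have hUa : U (Lp.compMeasurePreserving a ha g) = Lp.compMeasurePreserving b hb g := by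
    subst hRa
    exact (Lp.compMeasurePreserving_comp_apply g ha hR).symm
  have hUb : U (Lp.compMeasurePreserving b hb f) = Lp.compMeasurePreserving a ha f := by
    subst hRb
    exact (Lp.compMeasurePreserving_comp_apply f hb hR).symm
  rw [ContinuousLinearMap.coe_coe, real_inner_comm, inner_conditionalOperator,
    inner_conditionalOperator, ← hUa, ← hUb, U.inner_map_map, real_inner_comm]

theorem MaxCorrLE.of_norm_conditionalOperator_le [IsProbabilityMeasure μ] {c : ℝ}
    (h : ∀ (g : B → ℝ) (hg : MemLp g 2 β), ∫ y, g y ∂β = 0 →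
      ‖conditionalOperator ha hb hg.toLp‖ ≤ c * ‖hg.toLp‖) : MaxCorrLE a b c μ := by
  refine .of_centered ha.aemeasurable hb.aemeasurable fun f g hf hg _ hg0 ↦ ?_
  rw [ha.map_eq] at hf
  rw [hb.map_eq] at hg
  have hg0' : ∫ y, g y ∂β = 0 := (integral_comp_of_measurePreserving hb hg.1).symm.trans hg0
  calc |∫ ω, f (a ω) * g (b ω) ∂μ|
      = |inner ℝ hf.toLp (conditionalOperator ha hb hg.toLp)| := by
        rw [inner_conditionalOperator_toLp]
    _ ≤ ‖hf.toLp‖ * ‖conditionalOperator ha hb hg.toLp‖ := abs_real_inner_le_norm _ _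
    _ ≤ ‖hf.toLp‖ * (c * ‖hg.toLp‖) := by gcongr; exact h g hg hg0'
    _ = c * (√(∫ ω, f (a ω) ^ 2 ∂μ) * √(∫ ω, g (b ω) ^ 2 ∂μ)) := by
        rw [norm_toLp_eq_sqrt, norm_toLp_eq_sqrt,
          integral_comp_of_measurePreserving (f := fun x ↦ f x ^ 2) ha (hf.1.pow 2),
          integral_comp_of_measurePreserving (f := fun y ↦ g y ^ 2) hb (hg.1.pow 2)]
        ring

end ConditionalOperator

section Polynomial

open Polynomial

variable {s : Set ℝ} [CompactSpace s] {ν : Measure s} [IsFiniteMeasure ν]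

theorem memLp_eval_polynomial (p : ℝ[X]) : MemLp (fun t : s ↦ p.eval t.1) 2 ν :=
  ContinuousMap.memLp ν ℝ (p.toContinuousMapOn s)

/-- The class in `L²` of a polynomial function. -/
noncomputable def polynomialLp (ν : Measure s) [IsFiniteMeasure ν] : ℝ[X] →ₗ[ℝ] Lp ℝ 2 ν :=
  (ContinuousMap.toLp 2 ν ℝ).toLinearMap ∘ₗ (toContinuousMapOnAlgHom s).toLinearMap

theorem polynomialLp_eq_toLp (p : ℝ[X]) : polynomialLp ν p = (memLp_eval_polynomial p).toLp :=
  rfl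

theorem polynomialLp_mem_span_of_degree_lt {p : ℝ[X]} {k : ℕ} (hp : p.degree < k) :
    polynomialLp ν p ∈ Submodule.span ℝ ((fun i ↦ polynomialLp ν (X ^ i)) '' Set.Iio k) := by
  have hmem := Submodule.mem_map_of_mem (f := polynomialLp ν) (mem_degreeLT.2 hp)
  rwa [degreeLT_eq_span_X_pow, Submodule.map_span, Finset.coe_image, Set.image_image,
    Finset.coe_range] at hmem

theorem topologicalClosure_span_polynomialLp :
    (Submodule.span ℝ (Set.range fun i ↦ polynomialLp ν (X ^ i))).topologicalClosure = ⊤ := by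
  have hpoly : (polynomialFunctions s).toSubmodule.topologicalClosure = ⊤ :=
    congrArg Subalgebra.toSubmodule (polynomialFunctions.topologicalClosure s)
  refine top_unique (((ContinuousMap.toLp_denseRange (p := 2) ℝ ν ℝ
    ENNReal.ofNat_ne_top).topologicalClosure_map_submodule hpoly).ge.trans
    (Submodule.topologicalClosure_mono ?_))
  rintro _ ⟨_, ⟨p, -, rfl⟩, rfl⟩
  exact Submodule.span_mono (Set.image_subset_range _ _)
    (polynomialLp_mem_span_of_degree_lt (degree_le_natDegree.trans_lt
      (Nat.cast_lt.2 p.natDegree.lt_succ_self)))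

theorem maxCorrLE_of_triangular_moments {Ω : Type*} [MeasurableSpace Ω] {μ : Measure Ω}
    [IsProbabilityMeasure μ] {a b : Ω → s} {R : Ω → Ω} {c : ℝ} {l : ℕ → ℝ}
    (ha : MeasurePreserving a μ ν) (hb : MeasurePreserving b μ ν) (hR : MeasurePreserving R μ μ)
    (hRa : a ∘ R = b) (hRb : b ∘ R = a) (hc : 0 ≤ c) (hl : ∀ k ≠ 0, |l k| ≤ c)
    (hmoment : ∀ k : ℕ, ∃ q : ℝ[X], q.degree < k ∧ ∀ F : s → ℝ, MemLp F 2 ν →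
      ∫ ω, F (a ω) * (b ω : ℝ) ^ k ∂μ = ∫ t, F t * (l k * (t : ℝ) ^ k + q.eval ↑t) ∂ν) :
    MaxCorrLE a b c μ := by
  have htri (k : ℕ) : conditionalOperator ha hb (polynomialLp ν (X ^ k)) -
      l k • polynomialLp ν (X ^ k) ∈
        Submodule.span ℝ ((fun i ↦ polynomialLp ν (X ^ i)) '' Set.Iio k) := by
    obtain ⟨q, hq, hF⟩ := hmoment k
    convert polynomialLp_mem_span_of_degree_lt hq
    refine sub_eq_iff_eq_add'.2 (ext_inner_left ℝ fun f ↦ ?_)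
    rw [← Lp.toLp_coeFn f (Lp.memLp f), ← map_smul, ← map_add, polynomialLp_eq_toLp,
      polynomialLp_eq_toLp, inner_conditionalOperator_toLp, inner_toLp_toLp]
    simpa using hF f (Lp.memLp f)
  refine .of_norm_conditionalOperator_le (ha := ha) (hb := hb) fun g hg hg0 ↦
    norm_map_le_of_triangular (isSymmetric_conditionalOperator hR hRa hRb) htri
      topologicalClosure_span_polynomialLp hc hl ?_
  rw [polynomialLp_eq_toLp, inner_toLp_toLp]
  simpa using hg0

end Polynomial

section Variance

open ProbabilityTheory

variable {Ω : Type*} [MeasurableSpace Ω] {μ : Measure Ω} [IsProbabilityMeasure μ] {X Y Z : Ω → ℝ}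

theorem variance_half_add_half_le (hX : MemLp X 2 μ) (hY : MemLp Y 2 μ) :
    Var[fun ω ↦ 1 / 2 * X ω + 1 / 2 * Y ω; μ] ≤ 1 / 2 * Var[X; μ] + 1 / 2 * Var[Y; μ] := by
  have hdiff := variance_nonneg (X - Y) μ
  rw [variance_sub hX hY] at hdiff
  have hhalf : (fun ω ↦ 1 / 2 * X ω + 1 / 2 * Y ω) = fun ω ↦ 1 / 2 * (X + Y) ω :=
    funext fun ω ↦ (mul_add _ _ _).symm
  rw [hhalf, variance_const_mul, variance_add hX hY]
  linarith

theorem variance_add_variance_le_of_covariance_eq_variance {c : ℝ} (hc : 0 ≤ c)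
    (hX : MemLp X 2 μ) (hY : MemLp Y 2 μ) (hZ : MemLp Z 2 μ) (hXY : cov[X, Y; μ] = Var[Y; μ])
    (hXZ : cov[X, Z; μ] = Var[Z; μ]) (hYZ : |cov[Y, Z; μ]| ≤ c * (√Var[Y; μ] * √Var[Z; μ])) :
    Var[Y; μ] + Var[Z; μ] ≤ (1 + c) * Var[X; μ] := by
  have hYZ' : Var[Y + Z; μ] ≤ (1 + c) * (Var[Y; μ] + Var[Z; μ]) := by
    have hamgm := two_mul_le_add_sq √Var[Y; μ] √Var[Z; μ]
    rw [Real.sq_sqrt (variance_nonneg _ _), Real.sq_sqrt (variance_nonneg _ _)] at hamgm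
    rw [variance_add hY hZ]
    nlinarith [(le_abs_self _).trans hYZ]
  have hnonneg := variance_nonneg (fun ω ↦ (1 + c) * X ω - (Y + Z) ω) μ
  rw [variance_fun_sub (hX.const_mul _) (hY.add hZ), variance_const_mul,
    covariance_const_mul_left, covariance_add_right hX hY hZ, hXY, hXZ] at hnonneg
  nlinarith

end Variance

section Averaging

open ProbabilityTheory

/-- The average `𝔼_{i ∼ P} [f ∘ T i]` over the weights `P`; on a power of a space it is the real
form of `averagingOperator`. -/
noncomputable def weightedAverage {ι Z : Type*} (P : ι →₀ ℝ) (T : ι → Z → Z) (f : Z → ℝ) (z : Z) :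
    ℝ :=
  P.sum fun i w ↦ w * f (T i z)

/-- The average over `P` multiplies variances by at most `κ`; this is the spectral gap condition
without reference to mean-zero functions. -/
def ContractsVariance {ι Z : Type*} [MeasurableSpace Z] (P : ι →₀ ℝ) (T : ι → Z → Z) (κ : ℝ)
    (ζ : Measure Z) : Prop :=
  ∀ f : Z → ℝ, MemLp f 2 ζ → Var[weightedAverage P T f; ζ] ≤ κ * Var[f; ζ]

/-- The average with equal weights of the push-forwards of `P` under `g` and `h`. -/
noncomputable def mixture {ι κ : Type*} (P : ι →₀ ℝ) (g h : ι → κ) : κ →₀ ℝ :=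
  (1 / 2 : ℝ) • P.mapDomain g + (1 / 2 : ℝ) • P.mapDomain h

section Weights

variable {ι κ : Type*} {P : ι →₀ ℝ}

theorem isProbabilityWeight_mixture (hP : IsProbabilityWeight P) (g h : ι → κ) :
    IsProbabilityWeight (mixture P g h) := by
  have hnonneg (g : ι → κ) (k : κ) : 0 ≤ P.mapDomain g k :=
    Finsupp.mapDomain_nonneg (g := P) hP.1 k
  have hsum (g : ι → κ) : ((P.mapDomain g).sum fun _ w ↦ w) = 1 := by
    rw [Finsupp.sum_mapDomain_index (fun _ ↦ rfl) (fun _ _ _ ↦ rfl), hP.2]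
  constructor
  · intro k
    have hg := hnonneg g k
    have hh := hnonneg h k
    simp only [mixture, Finsupp.add_apply, Finsupp.smul_apply, smul_eq_mul]
    positivity
  · rw [mixture, Finsupp.sum_add_index' (fun _ ↦ rfl) (fun _ _ _ ↦ rfl),
      Finsupp.sum_smul_index fun _ ↦ rfl, Finsupp.sum_smul_index fun _ ↦ rfl, ← Finsupp.mul_sum,
      ← Finsupp.mul_sum, hsum, hsum]
    norm_num

theorem exists_mem_support_of_mem_support_mixture {g h : ι → κ} {k : κ}
    (hk : k ∈ (mixture P g h).support) : ∃ i ∈ P.support, k = g i ∨ k = h i := by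
  classical
  rcases Finset.mem_union.1 (Finsupp.support_add hk) with hk | hk <;>
    obtain ⟨i, hi, rfl⟩ := Finset.mem_image.1
      (Finsupp.mapDomain_support (Finsupp.support_smul hk))
  exacts [⟨i, hi, .inl rfl⟩, ⟨i, hi, .inr rfl⟩]

variable {Z : Type*} {S : ι → Z → Z}

theorem weightedAverage_mixture (g h : ι → κ) (T : κ → Z → Z) (f : Z → ℝ) :
    weightedAverage (mixture P g h) T f =
      fun z ↦ 1 / 2 * weightedAverage P (T ∘ g) f z + 1 / 2 * weightedAverage P (T ∘ h) f z := by
  have hmap (g : ι → κ) (z : Z) :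
      ((P.mapDomain g).sum fun i w ↦ w * f (T i z)) = weightedAverage P (T ∘ g) f z :=
    Finsupp.sum_mapDomain_index (fun _ ↦ zero_mul _) fun _ _ _ ↦ add_mul _ _ _
  ext z
  rw [weightedAverage, mixture, Finsupp.sum_add_index' (fun _ ↦ zero_mul _)
    (fun _ _ _ ↦ add_mul _ _ _), Finsupp.sum_smul_index fun _ ↦ zero_mul _,
    Finsupp.sum_smul_index fun _ ↦ zero_mul _]
  simp only [mul_assoc, ← Finsupp.mul_sum, hmap]

theorem weightedAverage_sub_const (hP : IsProbabilityWeight P) (f : Z → ℝ) (m : ℝ) :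
    weightedAverage P S (fun z ↦ f z - m) = fun z ↦ weightedAverage P S f z - m := by
  ext z
  simp only [weightedAverage, mul_sub, Finsupp.sum_sub, ← Finsupp.sum_mul, hP.2, one_mul]

theorem weightedAverage_comp_join {T Y : Type*} {join : T × Y → Z} {R : ι → Y → Y} {f : Z → ℝ}
    (hS : ∀ i t y, S i (join (t, y)) = join (t, R i y)) (t : T) (y : Y) :
    weightedAverage P S f (join (t, y)) = weightedAverage P R (fun y ↦ f (join (t, y))) y := by
  simp only [weightedAverage, hS]

variable [MeasurableSpace Z] {ζ : Measure Z}

theorem memLp_weightedAverage (P : ι →₀ ℝ) (hS : ∀ i, MeasurePreserving (S i) ζ ζ) {f : Z → ℝ}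
    (hf : MemLp f 2 ζ) : MemLp (weightedAverage P S f) 2 ζ :=
  memLp_finsetSum P.support fun i _ ↦ (hf.comp_measurePreserving (hS i)).const_mul (P i)

theorem integral_weightedAverage (hP : IsProbabilityWeight P)
    (hS : ∀ i, MeasurePreserving (S i) ζ ζ) {f : Z → ℝ} (hf : Integrable f ζ) :
    ∫ z, weightedAverage P S f z ∂ζ = ∫ z, f z ∂ζ := by
  simp only [weightedAverage, Finsupp.sum]
  have hint (i : ι) : Integrable (fun z ↦ f (S i z)) ζ := (hS i).integrable_comp_of_integrable hf
  rw [integral_finsetSum _ fun i _ ↦ (hint i).const_mul (P i)]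
  simp_rw [integral_const_mul, integral_comp_of_measurePreserving (hS _) hf.1, ← Finset.sum_mul]
  exact (congrArg (· * _) hP.2).trans (one_mul _)

end Weights

theorem eLpNorm_eq_sqrt_variance_re_add_variance_im {Z : Type*} [MeasurableSpace Z]
    {ζ : Measure Z} [IsProbabilityMeasure ζ] {f : Z → ℂ} (hf : MemLp f 2 ζ)
    (hf0 : ∫ z, f z ∂ζ = 0) :
    eLpNorm f 2 ζ =
      ENNReal.ofReal √(Var[fun z ↦ (f z).re; ζ] + Var[fun z ↦ (f z).im; ζ]) := by
  have hre : MemLp (fun z ↦ (f z).re) 2 ζ := hf.re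
  have him : MemLp (fun z ↦ (f z).im) 2 ζ := hf.im
  have hint := hf.integrable one_le_two
  have hre0 : ∫ z, (f z).re ∂ζ = 0 := by simpa [hf0] using integral_re hint
  have him0 : ∫ z, (f z).im ∂ζ = 0 := by simpa [hf0] using integral_im hint
  have hnorm : eLpNorm f 2 ζ = ENNReal.ofReal √(∫ z, ‖f z‖ ^ 2 ∂ζ) := by
    rw [← eLpNorm_norm, ← norm_toLp_eq_sqrt hf.norm, Lp.norm_toLp,
      ENNReal.ofReal_toReal hf.norm.eLpNorm_ne_top]
  rw [hnorm, variance_of_integral_eq_zero hre.1.aemeasurable hre0,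
    variance_of_integral_eq_zero him.1.aemeasurable him0,
    ← integral_add hre.integrable_sq him.integrable_sq]
  simp only [Complex.sq_norm, Complex.normSq_apply, ← sq]

namespace MeasurePreservingBijection

variable {M : Type*} [MeasurableSpace M] {μ : Measure M}

/-- The diagonal action of a measure-preserving bijection on the `n`-th power of the space. -/
def diagonal (n : ℕ) (φ : MeasurePreservingBijection μ) (x : Fin n → M) : Fin n → M :=
  fun i ↦ φ.1 (x i)

theorem measurePreserving_diagonal [SigmaFinite μ] (n : ℕ) (φ : MeasurePreservingBijection μ) :
    MeasurePreserving (φ.diagonal n) (.pi fun _ ↦ μ) (.pi fun _ ↦ μ) :=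
  measurePreserving_pi _ _ fun _ ↦ φ.2

end MeasurePreservingBijection

open MeasurePreservingBijection

section Operator

variable {M : Type*} [MeasurableSpace M] {μ : Measure M} {P : MeasurePreservingBijection μ →₀ ℝ}
  {n : ℕ}

theorem re_averagingOperator (f : (Fin n → M) → ℂ) (x : Fin n → M) :
    (averagingOperator P f x).re = weightedAverage P (diagonal n) (fun x ↦ (f x).re) x := by
  rw [averagingOperator, Finsupp.sum, Complex.re_sum]
  exact Finset.sum_congr rfl fun φ _ ↦ Complex.re_ofReal_mul _ _

theorem im_averagingOperator (f : (Fin n → M) → ℂ) (x : Fin n → M) :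
    (averagingOperator P f x).im = weightedAverage P (diagonal n) (fun x ↦ (f x).im) x := by
  rw [averagingOperator, Finsupp.sum, Complex.im_sum]
  exact Finset.sum_congr rfl fun φ _ ↦ Complex.im_ofReal_mul _ _

variable [IsProbabilityMeasure μ]

theorem memLp_averagingOperator (P : MeasurePreservingBijection μ →₀ ℝ) {f : (Fin n → M) → ℂ}
    (hf : MemLp f 2 (.pi fun _ ↦ μ)) : MemLp (averagingOperator P f) 2 (.pi fun _ ↦ μ) :=
  memLp_finsetSum P.support fun φ _ ↦
    (hf.comp_measurePreserving (measurePreserving_diagonal n φ)).const_mul (P φ : ℂ)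

theorem integral_averagingOperator (hP : IsProbabilityWeight P) {f : (Fin n → M) → ℂ}
    (hf : MemLp f 2 (.pi fun _ ↦ μ)) :
    ∫ x, averagingOperator P f x ∂(.pi fun _ ↦ μ) = ∫ x, f x ∂(.pi fun _ ↦ μ) := by
  have hint := hf.integrable one_le_two
  have hint' := (memLp_averagingOperator P hf).integrable one_le_two
  have hre := integral_weightedAverage hP (measurePreserving_diagonal n) hint.re
  have him := integral_weightedAverage hP (measurePreserving_diagonal n) hint.im
  rw [← integral_re_add_im hint', ← integral_re_add_im hint]
  simp only [RCLike.re_to_complex, RCLike.im_to_complex, re_averagingOperator,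
    im_averagingOperator] at hre him ⊢
  rw [hre, him]

theorem eLpNorm_averagingOperator (hP : IsProbabilityWeight P) {f : (Fin n → M) → ℂ}
    (hf : MemLp f 2 (.pi fun _ ↦ μ)) (hf0 : ∫ x, f x ∂(.pi fun _ ↦ μ) = 0) :
    eLpNorm (averagingOperator P f) 2 (.pi fun _ ↦ μ) =
      ENNReal.ofReal √(Var[weightedAverage P (diagonal n) fun x ↦ (f x).re; .pi fun _ ↦ μ] +
        Var[weightedAverage P (diagonal n) fun x ↦ (f x).im; .pi fun _ ↦ μ]) := by
  rw [eLpNorm_eq_sqrt_variance_re_add_variance_im (memLp_averagingOperator P hf)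
    ((integral_averagingOperator hP hf).trans hf0)]
  simp only [re_averagingOperator, im_averagingOperator]

theorem eLpNorm_averagingOperator_le_iff_contractsVariance (hP : IsProbabilityWeight P) {c : ℝ}
    (hc : 0 ≤ c) :
    (∀ f : (Fin n → M) → ℂ, MemLp f 2 (.pi fun _ ↦ μ) → ∫ x, f x ∂(.pi fun _ ↦ μ) = 0 →
      eLpNorm (averagingOperator P f) 2 (.pi fun _ ↦ μ) ≤
        ENNReal.ofReal c * eLpNorm f 2 (.pi fun _ ↦ μ)) ↔
      ContractsVariance P (diagonal n) (c ^ 2) (.pi fun _ ↦ μ) := by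
  constructor
  · intro h f hf
    set m := ∫ x, f x ∂(.pi fun _ ↦ μ) with hm
    have hfm : MemLp (fun x ↦ f x - m) 2 (.pi fun _ ↦ μ) := hf.sub (memLp_const m)
    have hg : MemLp (fun x ↦ ((f x - m : ℝ) : ℂ)) 2 (.pi fun _ ↦ μ) := hfm.ofReal
    have hg0 : ∫ x, ((f x - m : ℝ) : ℂ) ∂(.pi fun _ ↦ μ) = 0 := by
      rw [integral_complex_ofReal, integral_sub (hf.integrable one_le_two) (integrable_const m)]
      simp [hm]
    have hle := h _ hg hg0
    rw [eLpNorm_averagingOperator hP hg hg0,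
      eLpNorm_eq_sqrt_variance_re_add_variance_im hg hg0] at hle
    have hRe : (fun x ↦ ((f x - m : ℝ) : ℂ).re) = fun x ↦ f x - m := rfl
    have hIm : (fun x ↦ ((f x - m : ℝ) : ℂ).im) = 0 := rfl
    have hIm' : weightedAverage P (diagonal n) (0 : (Fin n → M) → ℝ) = 0 :=
      funext fun _ ↦ by simp [weightedAverage]
    rw [hRe, hIm, hIm', variance_zero, add_zero, add_zero, weightedAverage_sub_const hP,
      variance_sub_const (memLp_weightedAverage P (measurePreserving_diagonal n) hf).1,
      variance_sub_const hf.1, ← ENNReal.ofReal_mul hc,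
      ENNReal.ofReal_le_ofReal_iff (by positivity), ← Real.sqrt_sq hc,
      ← Real.sqrt_mul (sq_nonneg c)] at hle
    exact (Real.sqrt_le_sqrt_iff (mul_nonneg (sq_nonneg c) (variance_nonneg _ _))).1 hle
  · intro h f hf hf0
    rw [eLpNorm_averagingOperator hP hf hf0, eLpNorm_eq_sqrt_variance_re_add_variance_im hf hf0,
      ← ENNReal.ofReal_mul hc, ← Real.sqrt_sq hc, ← Real.sqrt_mul (sq_nonneg c), mul_add]
    exact ENNReal.ofReal_le_ofReal
      (Real.sqrt_le_sqrt (add_le_add (h _ hf.re) (h _ hf.im)))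

end Operator

end Averaging

section FibreAverage

open ProbabilityTheory

variable {Z T Y : Type*} [MeasurableSpace Z] [MeasurableSpace T] [MeasurableSpace Y]
  {ζ : Measure Z} {τ : Measure T} {η : Measure Y} [IsProbabilityMeasure η]
  {join : T × Y → Z} {height : Z → T} {R : Z → Z} {f : Z → ℝ}

/-- The conditional expectation of `f` given the base coordinate, when `join` presents `Z` as the
product of the base `T` and the fibre `Y`. -/
noncomputable def fibreAverage (η : Measure Y) (join : T × Y → Z) (f : Z → ℝ) (t : T) : ℝ :=
  ∫ y, f (join (t, y)) ∂η

theorem memLp_fibreAverage [SFinite τ] (hjoin : MeasurePreserving join (τ.prod η) ζ)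
    (hf : MemLp f 2 ζ) :
    MemLp (fibreAverage η join f) 2 τ :=
  memLp_two_integral_fibre (hf.comp_measurePreserving hjoin)

theorem measurePreserving_height [SFinite τ] (hjoin : MeasurePreserving join (τ.prod η) ζ)
    (hheight : Measurable height) (hhj : ∀ t y, height (join (t, y)) = t) :
    MeasurePreserving height ζ τ := by
  refine ⟨hheight, ?_⟩
  rw [← hjoin.map_eq, Measure.map_map hheight hjoin.measurable]
  have hfst : height ∘ join = Prod.fst := funext fun p ↦ hhj p.1 p.2
  rw [hfst, measurePreserving_fst.map_eq]

variable [IsProbabilityMeasure τ]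

theorem variance_eq_integral_variance_fibre_add (hjoin : MeasurePreserving join (τ.prod η) ζ)
    (hf : MemLp f 2 ζ) :
    Var[f; ζ] = ∫ t, Var[fun y ↦ f (join (t, y)); η] ∂τ + Var[fibreAverage η join f; τ] := by
  rw [← hjoin.variance_fun_comp hf.1.aemeasurable]
  exact variance_prod (hf.comp_measurePreserving hjoin)

theorem covariance_fibreAverage_comp_height (hjoin : MeasurePreserving join (τ.prod η) ζ)
    (hheight : Measurable height) (hhj : ∀ t y, height (join (t, y)) = t) (hf : MemLp f 2 ζ) :
    cov[f, fibreAverage η join f ∘ height; ζ] = Var[fibreAverage η join f; τ] := by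
  have hE := memLp_fibreAverage hjoin hf
  have hEh := hE.comp_measurePreserving (measurePreserving_height hjoin hheight hhj)
  rw [← hjoin.map_eq, covariance_map (hjoin.map_eq.symm ▸ hf.1) (hjoin.map_eq.symm ▸ hEh.1)
    hjoin.aemeasurable, covariance_prod (hf.comp_measurePreserving hjoin)
    (hEh.comp_measurePreserving hjoin)]
  simp only [Function.comp_apply, hhj, covariance_const_right, integral_zero, zero_add,
    integral_const, probReal_univ, one_smul]
  exact covariance_self hE.1.aemeasurable

theorem variance_le_of_fibreAverage_ae_eq {g : Z → ℝ} {κ : ℝ}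
    (hjoin : MeasurePreserving join (τ.prod η) ζ) (hf : MemLp f 2 ζ) (hg : MemLp g 2 ζ)
    (hmean : fibreAverage η join g =ᵐ[τ] fibreAverage η join f)
    (hfibre : ∀ᵐ t ∂τ,
      Var[fun y ↦ g (join (t, y)); η] ≤ κ * Var[fun y ↦ f (join (t, y)); η]) :
    Var[g; ζ] ≤ κ * Var[f; ζ] + (1 - κ) * Var[fibreAverage η join f; τ] := by
  have hVf := integrable_variance_fibre (hf.comp_measurePreserving hjoin)
  have hVg := integrable_variance_fibre (hg.comp_measurePreserving hjoin)
  have hle := integral_mono_ae hVg (hVf.const_mul κ) hfibre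
  simp only [Function.comp_apply, integral_const_mul] at hle
  rw [variance_eq_integral_variance_fibre_add hjoin hg, variance_congr hmean,
    variance_eq_integral_variance_fibre_add hjoin hf]
  linarith

theorem variance_weightedAverage_le_of_lift {ι : Type*} {P : ι →₀ ℝ} {S : ι → Y → Y}
    {S' : ι → Z → Z} {κ : ℝ} (hP : IsProbabilityWeight P)
    (hSm : ∀ i, MeasurePreserving (S i) η η) (hS'm : ∀ i, MeasurePreserving (S' i) ζ ζ)
    (hjoin : MeasurePreserving join (τ.prod η) ζ)
    (hS : ∀ i t y, S' i (join (t, y)) = join (t, S i y)) (hcontr : ContractsVariance P S κ η)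
    (hf : MemLp f 2 ζ) :
    Var[weightedAverage P S' f; ζ] ≤
      κ * Var[f; ζ] + (1 - κ) * Var[fibreAverage η join f; τ] := by
  have hfibre := ae_memLp_two_fibre (hf.comp_measurePreserving hjoin)
  refine variance_le_of_fibreAverage_ae_eq hjoin hf (memLp_weightedAverage P hS'm hf) ?_ ?_
  · filter_upwards [hfibre] with t ht
    simp only [fibreAverage, weightedAverage_comp_join hS]
    exact integral_weightedAverage hP hSm (ht.integrable one_le_two)
  · filter_upwards [hfibre] with t ht
    simp only [weightedAverage_comp_join hS]
    exact hcontr _ ht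

variable [IsProbabilityMeasure ζ]

theorem variance_fibreAverage_add_le_of_maxCorrLE {c : ℝ} (hc : 0 ≤ c)
    (hjoin : MeasurePreserving join (τ.prod η) ζ) (hheight : Measurable height)
    (hhj : ∀ t y, height (join (t, y)) = t) (hR : MeasurePreserving R ζ ζ)
    (hRR : Function.Involutive R) (hcorr : MaxCorrLE height (height ∘ R) c ζ)
    (hf : MemLp f 2 ζ) :
    Var[fibreAverage η join f; τ] + Var[fibreAverage η join (f ∘ R); τ] ≤
      (1 + c) * Var[f; ζ] := by
  have hfR : MemLp (f ∘ R) 2 ζ := hf.comp_measurePreserving hR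
  have hπ := measurePreserving_height hjoin hheight hhj
  have hF := memLp_fibreAverage hjoin hf
  have hG := memLp_fibreAverage hjoin hfR
  have hFπ := hF.comp_measurePreserving hπ
  have hGπ := hG.comp_measurePreserving hπ
  have hGπR : MemLp (fibreAverage η join (f ∘ R) ∘ height ∘ R) 2 ζ :=
    hG.comp_measurePreserving (hπ.comp hR)
  have hcovR : cov[f, fibreAverage η join (f ∘ R) ∘ height ∘ R; ζ] =
      Var[fibreAverage η join (f ∘ R); τ] := by
    rw [← covariance_fibreAverage_comp_height hjoin hheight hhj hfR]
    rw [← covariance_comp_measurePreserving hR hfR.1 hGπ.1, Function.comp_assoc, hRR.comp_self]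
    rfl
  have hVF := hπ.variance_fun_comp hF.1.aemeasurable
  have hVG := (hπ.comp hR).variance_fun_comp hG.1.aemeasurable
  have hcorr' := hcorr (fibreAverage η join f) (fibreAverage η join (f ∘ R))
    (hπ.map_eq.symm ▸ hF) ((hπ.comp hR).map_eq.symm ▸ hG)
  rw [← hVF, ← hVG]
  exact variance_add_variance_le_of_covariance_eq_variance hc hf hFπ hGπR
    ((covariance_fibreAverage_comp_height hjoin hheight hhj hf).trans hVF.symm)
    (hcovR.trans hVG.symm) hcorr'

theorem variance_half_weightedAverage_add_half_conj_le {ι : Type*} {P : ι →₀ ℝ} {S : ι → Y → Y}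
    {S' : ι → Z → Z} {c κ : ℝ} (hc : 0 ≤ c) (hκ : κ ≤ 1) (hP : IsProbabilityWeight P)
    (hSm : ∀ i, MeasurePreserving (S i) η η) (hS'm : ∀ i, MeasurePreserving (S' i) ζ ζ)
    (hjoin : MeasurePreserving join (τ.prod η) ζ) (hheight : Measurable height)
    (hhj : ∀ t y, height (join (t, y)) = t)
    (hS : ∀ i t y, S' i (join (t, y)) = join (t, S i y)) (hcontr : ContractsVariance P S κ η)
    (hR : MeasurePreserving R ζ ζ) (hRR : Function.Involutive R)
    (hcorr : MaxCorrLE height (height ∘ R) c ζ) (hf : MemLp f 2 ζ) :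
    Var[fun z ↦ 1 / 2 * weightedAverage P S' f z + 1 / 2 * weightedAverage P S' (f ∘ R) (R z); ζ] ≤
      (1 - (1 - κ) * (1 - c) / 2) * Var[f; ζ] := by
  have hfR : MemLp (f ∘ R) 2 ζ := hf.comp_measurePreserving hR
  have hA := memLp_weightedAverage P hS'm hf
  have hAR := memLp_weightedAverage P hS'm hfR
  have hlift := variance_weightedAverage_le_of_lift hP hSm hS'm hjoin hS hcontr hf
  have hliftR := variance_weightedAverage_le_of_lift hP hSm hS'm hjoin hS hcontr hfR
  have hVfR : Var[f ∘ R; ζ] = Var[f; ζ] := hR.variance_fun_comp hf.1.aemeasurable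
  have hbase := variance_fibreAverage_add_le_of_maxCorrLE hc hjoin hheight hhj hR hRR hcorr hf
  have hhalf := variance_half_add_half_le hA (hAR.comp_measurePreserving hR)
  have hVAR := hR.variance_fun_comp hAR.1.aemeasurable
  simp only [Function.comp_def] at hhalf hVAR hliftR hVfR hbase ⊢
  rw [hVAR] at hhalf
  rw [hVfR] at hliftR
  linarith [mul_le_mul_of_nonneg_left hbase (sub_nonneg.2 hκ)]

end FibreAverage

section Criterion

theorem measurePreserving_pi_join {X Y T : Type*} [MeasurableSpace X] [MeasurableSpace Y]
    [MeasurableSpace T] {μ : Measure X} {η : Measure Y} {τ : Measure T} [SigmaFinite μ]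
    [SigmaFinite η] [SigmaFinite τ] {join : T × Y → X}
    (hjoin : MeasurePreserving join (τ.prod η) μ) (n : ℕ) :
    MeasurePreserving (fun (p : (Fin n → T) × (Fin n → Y)) i ↦ join (p.1 i, p.2 i))
      ((Measure.pi fun _ ↦ τ).prod (.pi fun _ ↦ η)) (.pi fun _ ↦ μ) :=
  (measurePreserving_pi _ _ fun _ ↦ hjoin).comp
    (measurePreserving_arrowProdEquivProdArrow T Y (Fin n) (fun _ ↦ τ) fun _ ↦ η).symm

namespace MeasurePreservingBijection

variable {X : Type*} [MeasurableSpace X] {μ : Measure X} {R : X → X}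

/-- The conjugate of a measure-preserving bijection by a measure-preserving involution. -/
def conj (hR : MeasurePreserving R μ μ) (hRR : Function.Involutive R)
    (φ : MeasurePreservingBijection μ) : MeasurePreservingBijection μ :=
  ⟨hRR.toPerm.trans (φ.1.trans hRR.toPerm), hR.comp (φ.2.comp hR)⟩

theorem weightedAverage_diagonal_conj {ι : Type*} (hR : MeasurePreserving R μ μ)
    (hRR : Function.Involutive R) (P : ι →₀ ℝ) (g : ι → MeasurePreservingBijection μ) {n : ℕ}
    (f : (Fin n → X) → ℝ) (x : Fin n → X) :
    weightedAverage P (diagonal n ∘ conj hR hRR ∘ g) f x =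
      weightedAverage P (diagonal n ∘ g) (f ∘ fun x i ↦ R (x i)) fun i ↦ R (x i) :=
  rfl

theorem lipschitzWith_conj {X : Type*} [MetricSpace X] [MeasurableSpace X] {μ : Measure X}
    {R : X → X} (hR : MeasurePreserving R μ μ) (hRR : Function.Involutive R) (hRiso : Isometry R)
    {φ : MeasurePreservingBijection μ} {K : ℝ≥0}
    (hφ : LipschitzWith K φ.1 ∧ LipschitzWith K φ.1.symm) :
    LipschitzWith K (conj hR hRR φ).1 ∧ LipschitzWith K (conj hR hRR φ).1.symm := by
  have hconj {g : X → X} (hg : LipschitzWith K g) : LipschitzWith K (R ∘ g ∘ R) := by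
    simpa using hRiso.lipschitz.comp (hg.comp hRiso.lipschitz)
  exact ⟨hconj hφ.1, hconj hφ.2⟩

end MeasurePreservingBijection

open MeasurePreservingBijection

section Join

variable {X Y T : Type*} [MeasurableSpace X] [MeasurableSpace Y] [MeasurableSpace T]
  {μ : Measure X} {η : Measure Y} {τ : Measure T} [IsProbabilityMeasure μ]
  [IsProbabilityMeasure η] [IsProbabilityMeasure τ] {join : T × Y → X} {height : X → T} {R : X → X}
  {lift : MeasurePreservingBijection η → MeasurePreservingBijection μ} {c : ℝ}

theorem contractsVariance_mixture_conj {P : MeasurePreservingBijection η →₀ ℝ} {κ : ℝ} {n : ℕ}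
    (hjoin : MeasurePreserving join (τ.prod η) μ) (hheight : Measurable height)
    (hhj : ∀ t y, height (join (t, y)) = t)
    (hlift : ∀ φ t y, (lift φ).1 (join (t, y)) = join (t, φ.1 y))
    (hR : MeasurePreserving R μ μ) (hRR : Function.Involutive R)
    (hc : 0 ≤ c) (hcorr : MaxCorrLE height (height ∘ R) c μ) (hκ : κ ≤ 1)
    (hP : IsProbabilityWeight P) (hcontr : ContractsVariance P (diagonal n) κ (.pi fun _ ↦ η)) :
    ContractsVariance (mixture P lift (conj hR hRR ∘ lift)) (diagonal n)
      (1 - (1 - κ) * (1 - c) / 2) (.pi fun _ ↦ μ) := by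
  intro f hf
  simp only [weightedAverage_mixture, weightedAverage_diagonal_conj]
  exact variance_half_weightedAverage_add_half_conj_le hc hκ hP
    (measurePreserving_diagonal n) (fun φ ↦ measurePreserving_diagonal n (lift φ))
    (measurePreserving_pi_join hjoin n)
    (measurable_pi_lambda _ fun i ↦ hheight.comp (measurable_pi_apply i))
    (fun t y ↦ funext fun i ↦ hhj (t i) (y i))
    (fun φ t y ↦ funext fun i ↦ hlift φ (t i) (y i)) hcontr
    (measurePreserving_pi _ _ fun _ ↦ hR) (fun x ↦ funext fun i ↦ hRR (x i))
    (hcorr.pi hc hheight (hheight.comp hR.measurable) n) hf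

end Join

theorem ExpandsUniformly.of_join {X Y T : Type*} [MetricSpace X] [MeasurableSpace X] [BorelSpace X]
    [MetricSpace Y] [MeasurableSpace Y] [BorelSpace Y] [MeasurableSpace T] {μ : Measure X}
    {η : Measure Y} {τ : Measure T} [IsProbabilityMeasure μ] [IsProbabilityMeasure η]
    [IsProbabilityMeasure τ] {join : T × Y → X} {height : X → T} {R : X → X}
    {lift : MeasurePreservingBijection η → MeasurePreservingBijection μ} {L : ℝ≥0 → ℝ≥0} {c : ℝ}
    (hjoin : MeasurePreserving join (τ.prod η) μ) (hheight : Measurable height)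
    (hhj : ∀ t y, height (join (t, y)) = t)
    (hlift : ∀ φ t y, (lift φ).1 (join (t, y)) = join (t, φ.1 y))
    (hLip : ∀ K φ, LipschitzWith K φ.1 ∧ LipschitzWith K φ.1.symm →
      LipschitzWith (L K) (lift φ).1 ∧ LipschitzWith (L K) (lift φ).1.symm)
    (hR : MeasurePreserving R μ μ) (hRR : Function.Involutive R) (hRiso : Isometry R)
    (hc : 0 ≤ c) (hc1 : c < 1) (hcorr : MaxCorrLE height (height ∘ R) c μ)
    (h : ExpandsUniformly Y η) : ExpandsUniformly X μ := by
  obtain ⟨K, ρ, hρ, hρ1, P, hP, hK, hexp⟩ := h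
  have hκ : (1 - ρ) ^ 2 < 1 := by nlinarith
  have hgap : 0 < (1 - (1 - ρ) ^ 2) * (1 - c) := mul_pos (sub_pos.2 hκ) (sub_pos.2 hc1)
  have hgap1 : (1 - (1 - ρ) ^ 2) * (1 - c) ≤ 1 :=
    mul_le_one₀ (sub_le_self _ (sq_nonneg _)) (sub_nonneg.2 hc1.le) (sub_le_self _ hc)
  have hQ := isProbabilityWeight_mixture hP lift (conj hR hRR ∘ lift)
  refine ⟨L K, (1 - (1 - ρ) ^ 2) * (1 - c) / 4, by positivity, by linarith,
    mixture P lift (conj hR hRR ∘ lift), hQ, fun ψ hψ ↦ ?_, fun n hn ↦ ?_⟩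
  · obtain ⟨φ, hφ, rfl | rfl⟩ := exists_mem_support_of_mem_support_mixture hψ
    · exact hLip K φ (hK φ hφ)
    · exact lipschitzWith_conj hR hRR hRiso (hLip K φ (hK φ hφ))
  · rw [eLpNorm_averagingOperator_le_iff_contractsVariance hQ (by linarith)]
    refine fun f hf ↦ (contractsVariance_mixture_conj hjoin hheight hhj hlift hR hRR hc hcorr hκ.le
      hP ((eLpNorm_averagingOperator_le_iff_contractsVariance hP (sub_nonneg.2 hρ1)).1 (hexp n hn))
      f hf).trans ?_
    refine mul_le_mul_of_nonneg_right ?_ (ProbabilityTheory.variance_nonneg _ _)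
    nlinarith

end Criterion

namespace RoundSphere

section RadialProjection

variable {d : ℕ}

/-- The point of the sphere with a given coordinate vector of norm one. -/
def ofCoords (v : EuclideanSpace ℝ (Fin (d + 1))) (hv : ‖v‖ = 1) : RoundSphere d :=
  ⟨v, mem_sphere_zero_iff_norm.2 hv⟩

@[simp]
theorem coords_ofCoords (v : EuclideanSpace ℝ (Fin (d + 1))) (hv : ‖v‖ = 1) :
    (ofCoords v hv).coords = v := rfl

theorem measurable_coords : Measurable (coords (d := d)) := measurable_subtype_coe

theorem measurable_of_measurable_coords {A : Type*} [MeasurableSpace A] {f : A → RoundSphere d}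
    (hf : Measurable fun a ↦ (f a).coords) : Measurable f := by
  rintro _ ⟨u, hu, rfl⟩
  exact hf hu

/-- The radial projection `v ↦ v / ‖v‖` onto the sphere; the origin is sent to an arbitrary
point. -/
noncomputable def radialProjection (v : EuclideanSpace ℝ (Fin (d + 1))) : RoundSphere d :=
  if h : v = 0 then ofCoords (EuclideanSpace.single 0 1) (by simp)
  else ofCoords (NormedSpace.normalize v) (NormedSpace.norm_normalize h)

theorem coords_radialProjection {v : EuclideanSpace ℝ (Fin (d + 1))} (h : v ≠ 0) :
    (radialProjection v).coords = NormedSpace.normalize v := by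
  simp [radialProjection, h]

theorem norm_smul_coords_radialProjection (v : EuclideanSpace ℝ (Fin (d + 1))) :
    ‖v‖ • (radialProjection v).coords = v := by
  by_cases h : v = 0
  · simp [h]
  · rw [coords_radialProjection h, NormedSpace.norm_smul_normalize]

theorem radialProjection_smul_coords {r : ℝ} (hr : 0 < r) (y : RoundSphere d) :
    radialProjection (r • y.coords) = y := by
  apply coords_injective
  rw [coords_radialProjection (smul_ne_zero hr.ne' (coords_ne_zero y)),
    NormedSpace.normalize_smul_of_pos hr,
    NormedSpace.normalize_eq_self_of_norm_eq_one y.norm_coords]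

theorem measurable_radialProjection : Measurable (radialProjection (d := d)) := by
  apply measurable_of_measurable_coords
  have hcoords : (fun v ↦ (radialProjection (d := d) v).coords) =
      fun v ↦ if v = 0 then EuclideanSpace.single 0 1 else ‖v‖⁻¹ • v := by
    funext v
    by_cases h : v = 0 <;> simp [h, radialProjection, NormedSpace.normalize]
  rw [hcoords]
  exact Measurable.ite (measurableSet_singleton _) measurable_const
    (measurable_norm.inv.smul measurable_id)

open scoped Pointwise in
theorem Ioo_smul_image_coords (s : Set (RoundSphere d)) :
    Set.Ioo (0 : ℝ) 1 • coords '' s = (radialProjection ⁻¹' s ∩ Metric.ball 0 1) \ {0} := by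
  ext v
  simp only [Set.mem_smul, Set.mem_sdiff, Set.mem_inter_iff, Set.mem_preimage,
    mem_ball_zero_iff, Set.mem_singleton_iff]
  constructor
  · rintro ⟨r, ⟨hr, hr1⟩, _, ⟨y, hy, rfl⟩, rfl⟩
    rw [radialProjection_smul_coords hr, norm_smul, norm_coords, mul_one,
      Real.norm_of_nonneg hr.le]
    exact ⟨⟨hy, hr1⟩, smul_ne_zero hr.ne' (coords_ne_zero y)⟩
  · rintro ⟨⟨hs, hv1⟩, hv⟩
    exact ⟨‖v‖, ⟨norm_pos_iff.2 hv, hv1⟩, _, ⟨_, hs, rfl⟩, norm_smul_coords_radialProjection v⟩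

theorem measurePreserving_radialProjection (d : ℕ) :
    MeasurePreserving radialProjection
      (((d + 1 : ℕ) : ℝ≥0∞) •
        (volume : Measure (EuclideanSpace ℝ (Fin (d + 1)))).restrict (Metric.ball 0 1))
      (areaMeasure d) := by
  refine ⟨measurable_radialProjection, Measure.ext fun s hs ↦ ?_⟩
  rw [Measure.map_apply measurable_radialProjection hs, Measure.smul_apply,
    Measure.restrict_apply (measurable_radialProjection hs), smul_eq_mul]
  refine Eq.trans ?_ (Measure.toSphere_apply' _ hs).symm
  rw [finrank_euclideanSpace_fin, ← measure_sdiff_null (s := radialProjection ⁻¹' s ∩ _)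
    (measure_singleton (0 : EuclideanSpace ℝ (Fin (d + 1))))]
  exact congrArg (fun t ↦ ((d + 1 : ℕ) : ℝ≥0∞) * volume t) (Ioo_smul_image_coords s).symm

/-- The action of a linear isometry on the sphere. -/
noncomputable def isometryMap
    (U : EuclideanSpace ℝ (Fin (d + 1)) ≃ₗᵢ[ℝ] EuclideanSpace ℝ (Fin (d + 1)))
    (x : RoundSphere d) : RoundSphere d :=
  ofCoords (U x.coords) (by rw [U.norm_map, norm_coords])

theorem isometry_isometryMap
    (U : EuclideanSpace ℝ (Fin (d + 1)) ≃ₗᵢ[ℝ] EuclideanSpace ℝ (Fin (d + 1))) :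
    Isometry (isometryMap U) :=
  Isometry.of_dist_eq fun x y ↦ by simp [dist_eq_arccos, isometryMap]

theorem radialProjection_isometry_apply
    (U : EuclideanSpace ℝ (Fin (d + 1)) ≃ₗᵢ[ℝ] EuclideanSpace ℝ (Fin (d + 1)))
    {v : EuclideanSpace ℝ (Fin (d + 1))} (hv : v ≠ 0) :
    radialProjection (U v) = isometryMap U (radialProjection v) := by
  apply coords_injective
  simp [isometryMap, coords_radialProjection, hv, NormedSpace.normalize]

theorem measurePreserving_isometryMap
    (U : EuclideanSpace ℝ (Fin (d + 1)) ≃ₗᵢ[ℝ] EuclideanSpace ℝ (Fin (d + 1))) :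
    MeasurePreserving (isometryMap U) (uniformMeasure d) (uniformMeasure d) := by
  have hU : Measurable (isometryMap U) := (isometry_isometryMap U).continuous.measurable
  refine MeasurePreserving.smul_measure ⟨hU, ?_⟩ _
  have hball := U.measurePreserving.restrict_preimage (Metric.isOpen_ball (x := 0)).measurableSet
    (s := Metric.ball 0 1)
  rw [U.preimage_ball, map_zero] at hball
  have hproj := measurePreserving_radialProjection d
  have hae : radialProjection ∘ U =ᵐ[((d + 1 : ℕ) : ℝ≥0∞) •
      (volume : Measure (EuclideanSpace ℝ (Fin (d + 1)))).restrict (Metric.ball 0 1)]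
      isometryMap U ∘ radialProjection := by
    refine Measure.ae_smul_measure (ae_restrict_of_ae ?_) _
    filter_upwards [compl_mem_ae_iff.2 (measure_singleton 0)] with v hv
    exact radialProjection_isometry_apply U hv
  calc (areaMeasure d).map (isometryMap U)
      = _ := by rw [← hproj.map_eq, Measure.map_map hU hproj.measurable, ← Measure.map_congr hae]
    _ = areaMeasure d := (hproj.comp (hball.smul_measure _)).map_eq

end RadialProjection

end RoundSphere

namespace RoundSphere

section Join

variable {d : ℕ}

/-- The vector `(t, v)` of `ℝ^(n+1)`, for `t ∈ ℝ` and `v ∈ ℝ^n`. -/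
noncomputable def consVec {n : ℕ} (p : ℝ × EuclideanSpace ℝ (Fin n)) :
    EuclideanSpace ℝ (Fin (n + 1)) :=
  WithLp.toLp 2 (Fin.cons p.1 p.2.ofLp : Fin (n + 1) → ℝ)

section ConsVec

variable {n : ℕ}

theorem norm_consVec_sq (p : ℝ × EuclideanSpace ℝ (Fin n)) :
    ‖consVec p‖ ^ 2 = p.1 ^ 2 + ‖p.2‖ ^ 2 := by
  simp [consVec, EuclideanSpace.real_norm_sq_eq, Fin.sum_univ_succ]

theorem consVec_sub (p q : ℝ × EuclideanSpace ℝ (Fin n)) :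
    consVec p - consVec q = consVec (p - q) := by
  ext i
  refine Fin.cases ?_ (fun j ↦ ?_) i <;> simp [consVec]

theorem smul_consVec (c : ℝ) (p : ℝ × EuclideanSpace ℝ (Fin n)) :
    c • consVec p = consVec (c • p) := by
  ext i
  refine Fin.cases ?_ (fun j ↦ ?_) i <;> simp [consVec]

theorem measurePreserving_consVec : MeasurePreserving (consVec (n := n)) := by
  have hofLp : MeasurePreserving (Prod.map (id : ℝ → ℝ)
      (WithLp.ofLp : EuclideanSpace ℝ (Fin n) → Fin n → ℝ)) :=
    (MeasurePreserving.id volume).prod (PiLp.volume_preserving_ofLp _)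
  have hcons := (volume_preserving_piFinSuccAbove (fun _ : Fin (n + 1) ↦ ℝ) 0).symm
  convert (PiLp.volume_preserving_toLp (Fin (n + 1))).comp (hcons.comp hofLp) using 1
  funext p
  refine congrArg (WithLp.toLp 2) (funext fun i ↦ ?_)
  refine Fin.cases ?_ (fun j ↦ ?_) i <;> rfl

end ConsVec

theorem measurePreserving_polar (d : ℕ) :
    MeasurePreserving (fun p : Set.Ioi (0 : ℝ) × RoundSphere d ↦ (p.1 : ℝ) • p.2.coords)
      ((Measure.volumeIoiPow d).prod (areaMeasure d)) volume := by
  have hpolar := (volume : Measure (EuclideanSpace ℝ (Fin (d + 1)))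
    ).measurePreserving_homeomorphUnitSphereProd
  rw [finrank_euclideanSpace_fin, Nat.add_sub_cancel] at hpolar
  have hsymm := MeasurePreserving.symm
    (homeomorphUnitSphereProd (EuclideanSpace ℝ (Fin (d + 1)))).toMeasurableEquiv hpolar
  have hval : MeasurePreserving
      (Subtype.val : ({0}ᶜ : Set (EuclideanSpace ℝ (Fin (d + 1)))) → _)
      ((volume : Measure (EuclideanSpace ℝ (Fin (d + 1)))).comap Subtype.val) volume := by
    refine ⟨measurable_subtype_coe, ?_⟩
    rw [(MeasurableEmbedding.subtype_coe (measurableSet_singleton _).compl).map_comap,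
      Subtype.range_coe, Measure.restrict_eq_self_of_ae_mem]
    exact compl_mem_ae_iff.2 (measure_singleton _)
  exact (hval.comp hsymm).comp Measure.measurePreserving_swap

instance instIsFiniteMeasureAreaMeasure (d : ℕ) : IsFiniteMeasure (areaMeasure d) :=
  inferInstanceAs
    (IsFiniteMeasure ((volume : Measure (EuclideanSpace ℝ (Fin (d + 1)))).toSphere))

/-- Cylindrical coordinates: the vector `(s, r y)`, with axial coordinate `s`, distance `r` from the
axis and direction `y` orthogonally to it. -/
noncomputable def ofCylindrical (p : (ℝ × Set.Ioi (0 : ℝ)) × RoundSphere d) :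
    EuclideanSpace ℝ (Fin (d + 2)) :=
  consVec (p.1.1, (p.1.2 : ℝ) • p.2.coords)

theorem norm_ofCylindrical (p : (ℝ × Set.Ioi (0 : ℝ)) × RoundSphere d) :
    ‖ofCylindrical p‖ = √(p.1.1 ^ 2 + (p.1.2 : ℝ) ^ 2) := by
  rw [← Real.sqrt_sq (norm_nonneg (ofCylindrical p)), ofCylindrical, norm_consVec_sq, norm_smul,
    norm_coords, mul_one, Real.norm_eq_abs, sq_abs]

theorem measurePreserving_ofCylindrical (d : ℕ) :
    MeasurePreserving (ofCylindrical (d := d))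
      (((volume : Measure ℝ).prod (Measure.volumeIoiPow d)).prod (areaMeasure d)) volume :=
  measurePreserving_consVec.comp
    (((MeasurePreserving.id volume).prod (measurePreserving_polar d)).comp
      (measurePreserving_prodAssoc volume (Measure.volumeIoiPow d) (areaMeasure d)))

/-- The point of `S^(d+1)` at latitude `t` over the point `y` of the equator `S^d`. -/
noncomputable def join (p : Set.Icc (-1 : ℝ) 1 × RoundSphere d) : RoundSphere (d + 1) :=
  ofCoords (consVec (p.1.1, √(1 - p.1.1 ^ 2) • p.2.coords)) (by
    have h : 0 ≤ 1 - p.1.1 ^ 2 := by nlinarith [p.1.2.1, p.1.2.2]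
    rw [← sq_eq_sq₀ (norm_nonneg _) zero_le_one, norm_consVec_sq, norm_smul, norm_coords, mul_one,
      Real.norm_of_nonneg (Real.sqrt_nonneg _), Real.sq_sqrt h]
    ring)

theorem measurable_join : Measurable (join (d := d)) := by
  have hlat : Measurable fun p : Set.Icc (-1 : ℝ) 1 × RoundSphere d ↦ (p.1 : ℝ) :=
    measurable_subtype_coe.comp measurable_fst
  exact measurable_of_measurable_coords <| measurePreserving_consVec.measurable.comp <|
    hlat.prodMk <| (measurable_const.sub (hlat.pow_const 2)).sqrt.smul <|
      measurable_coords.comp measurable_snd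

/-- The latitude `s / √(s² + r²)` of the direction with axial component `s` and radial
component `r`. -/
noncomputable def directionLatitude (p : ℝ × Set.Ioi (0 : ℝ)) : Set.Icc (-1 : ℝ) 1 :=
  ⟨p.1 / √(p.1 ^ 2 + (p.2 : ℝ) ^ 2), by
    have h : |p.1| ≤ √(p.1 ^ 2 + (p.2 : ℝ) ^ 2) :=
      Real.abs_le_sqrt (le_add_of_nonneg_right (sq_nonneg _))
    rw [Set.mem_Icc, ← abs_le, abs_div, abs_of_nonneg (Real.sqrt_nonneg _)]
    exact div_le_one_of_le₀ h (Real.sqrt_nonneg _)⟩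

theorem measurable_directionLatitude : Measurable directionLatitude := by
  refine Measurable.subtype_mk ?_
  fun_prop

theorem sqrt_one_sub_directionLatitude_sq (p : ℝ × Set.Ioi (0 : ℝ)) :
    √(1 - (directionLatitude p : ℝ) ^ 2) = (p.2 : ℝ) / √(p.1 ^ 2 + (p.2 : ℝ) ^ 2) := by
  obtain ⟨s, r, hr : 0 < r⟩ := p
  have hpos : 0 < s ^ 2 + r ^ 2 := by positivity
  have hsq : 1 - (s / √(s ^ 2 + r ^ 2)) ^ 2 = (r / √(s ^ 2 + r ^ 2)) ^ 2 := by
    rw [div_pow, div_pow, Real.sq_sqrt hpos.le]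
    field_simp
    ring
  exact (congrArg Real.sqrt hsq).trans (Real.sqrt_sq (by positivity))

theorem radialProjection_ofCylindrical (p : (ℝ × Set.Ioi (0 : ℝ)) × RoundSphere d) :
    radialProjection (ofCylindrical p) = join (directionLatitude p.1, p.2) := by
  have hr : (0 : ℝ) < p.1.2 := p.1.2.2
  have hne : ofCylindrical p ≠ 0 := by
    rw [← norm_ne_zero_iff, norm_ofCylindrical]
    positivity
  apply coords_injective
  rw [coords_radialProjection hne, NormedSpace.normalize, norm_ofCylindrical, ofCylindrical,
    smul_consVec, join, coords_ofCoords, sqrt_one_sub_directionLatitude_sq, Prod.smul_mk, smul_smul,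
    smul_eq_mul, ← div_eq_inv_mul, ← div_eq_inv_mul]
  rfl

theorem exists_areaMeasure_succ_eq_map_join (d : ℕ) :
    ∃ α : Measure (Set.Icc (-1 : ℝ) 1), SFinite α ∧
      areaMeasure (d + 1) = (α.prod (areaMeasure d)).map join := by
  let halfPlane := (volume : Measure ℝ).prod (Measure.volumeIoiPow d)
  let halfDisc : Set (ℝ × Set.Ioi (0 : ℝ)) := {p | √(p.1 ^ 2 + (p.2 : ℝ) ^ 2) < 1}
  have hball : ofCylindrical (d := d) ⁻¹' Metric.ball 0 1 = halfDisc ×ˢ Set.univ := by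
    ext p
    simp only [Set.mem_preimage, mem_ball_zero_iff, Set.mem_prod, Set.mem_univ, and_true,
      norm_ofCylindrical, halfDisc, Set.mem_ofPred_eq]
  have hcyl := (measurePreserving_ofCylindrical d).restrict_preimage
    (Metric.isOpen_ball (x := 0) (ε := 1)).measurableSet
  rw [hball, ← Measure.prod_restrict, Measure.restrict_univ] at hcyl
  have hproj : radialProjection ∘ ofCylindrical = join (d := d) ∘ Prod.map directionLatitude id :=
    funext radialProjection_ofCylindrical
  have hpolar := (measurePreserving_radialProjection (d + 1)).comp
    (hcyl.smul_measure ((d + 1 + 1 : ℕ) : ℝ≥0∞))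
  rw [hproj] at hpolar
  refine ⟨((d + 1 + 1 : ℕ) : ℝ≥0∞) • (halfPlane.restrict halfDisc).map directionLatitude,
    inferInstance, ?_⟩
  rw [← hpolar.map_eq,
    ← Measure.map_map measurable_join (measurable_directionLatitude.prodMap measurable_id),
    Measure.map_smul, ← Measure.map_prod_map _ _ measurable_directionLatitude measurable_id,
    Measure.map_id, Measure.prod_smul_left]

/-- The `i`-th coordinate of a point of the sphere. -/
noncomputable def coord (i : Fin (d + 1)) (x : RoundSphere d) : Set.Icc (-1 : ℝ) 1 :=
  ⟨x.coords i, by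
    rw [Set.mem_Icc, ← abs_le, ← norm_coords x]
    exact PiLp.norm_apply_le x.coords i⟩

theorem measurable_coord (i : Fin (d + 1)) : Measurable (coord (d := d) i) := by
  refine Measurable.subtype_mk ?_
  exact (EuclideanSpace.proj i : EuclideanSpace ℝ (Fin (d + 1)) →L[ℝ] ℝ).continuous.measurable.comp
    measurable_coords

theorem coord_zero_join (t : Set.Icc (-1 : ℝ) 1) (y : RoundSphere d) :
    coord 0 (join (t, y)) = t := rfl

/-- The distribution of the first coordinate of a uniform random point of `S^(d+1)`. -/
noncomputable def latitudeMeasure (d : ℕ) : Measure (Set.Icc (-1 : ℝ) 1) :=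
  (uniformMeasure (d + 1)).map (coord 0)

instance instIsProbabilityMeasureLatitudeMeasure (d : ℕ) :
    IsProbabilityMeasure (latitudeMeasure d) :=
  Measure.isProbabilityMeasure_map (measurable_coord 0).aemeasurable

theorem measurePreserving_coord_zero (d : ℕ) :
    MeasurePreserving (coord 0) (uniformMeasure (d + 1)) (latitudeMeasure d) :=
  (measurable_coord 0).measurePreserving _

theorem areaMeasure_eq_smul_uniformMeasure (d : ℕ) :
    areaMeasure d = areaMeasure d Set.univ • uniformMeasure d := by
  have hne : areaMeasure d Set.univ ≠ 0 :=
    Measure.measure_univ_ne_zero.2 (Measure.toSphere_ne_zero _)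
  rw [uniformMeasure, smul_smul, ENNReal.mul_inv_cancel hne (measure_ne_top _ _), one_smul]

theorem measurePreserving_join (d : ℕ) :
    MeasurePreserving join ((latitudeMeasure d).prod (uniformMeasure d))
      (uniformMeasure (d + 1)) := by
  obtain ⟨α, _, hα⟩ := exists_areaMeasure_succ_eq_map_join d
  let ν := ((areaMeasure (d + 1) Set.univ)⁻¹ * areaMeasure d Set.univ) • α
  have hjoin : MeasurePreserving join (ν.prod (uniformMeasure d)) (uniformMeasure (d + 1)) := by
    refine ⟨measurable_join, ?_⟩
    rw [areaMeasure_eq_smul_uniformMeasure d, Measure.prod_smul_right, Measure.map_smul] at hα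
    rw [Measure.prod_smul_left, Measure.map_smul, mul_smul, ← hα, uniformMeasure]
  have hν : latitudeMeasure d = ν :=
    (measurePreserving_height hjoin (measurable_coord 0) coord_zero_join).map_eq
  rwa [hν]

end Join

end RoundSphere

namespace RoundSphere

section Correlation

open Polynomial

variable {d : ℕ}

/-- Interchange of the first two coordinates. -/
noncomputable def swap : RoundSphere (d + 1) → RoundSphere (d + 1) :=
  isometryMap (LinearIsometryEquiv.piLpCongrLeft 2 ℝ ℝ (Equiv.swap 0 1))

theorem coords_swap_apply (x : RoundSphere (d + 1)) (i : Fin (d + 2)) :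
    (swap x).coords i = x.coords (Equiv.swap 0 1 i) := by
  simp [swap, isometryMap, LinearIsometryEquiv.piLpCongrLeft_apply, Equiv.piCongrLeft']

theorem swap_involutive : Function.Involutive (swap (d := d)) := fun x ↦ by
  apply coords_injective
  ext i
  rw [coords_swap_apply, coords_swap_apply, Equiv.swap_apply_self]

theorem isometry_swap : Isometry (swap (d := d)) := isometry_isometryMap _

theorem measurePreserving_swap :
    MeasurePreserving (swap (d := d)) (uniformMeasure (d + 1)) (uniformMeasure (d + 1)) :=
  measurePreserving_isometryMap _

theorem coord_zero_swap (x : RoundSphere (d + 1)) : coord 0 (swap x) = coord 1 x :=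
  Subtype.ext (by simp [coord, coords_swap_apply])

theorem coord_zero_swap_join (t : Set.Icc (-1 : ℝ) 1) (y : RoundSphere d) :
    (coord 0 (swap (join (t, y))) : ℝ) = √(1 - (t : ℝ) ^ 2) * (coord 0 y : ℝ) := by
  rw [coord_zero_swap]
  rfl

theorem measurable_coord_pow (i : Fin (d + 1)) (k : ℕ) :
    Measurable fun x : RoundSphere d ↦ (coord i x : ℝ) ^ k :=
  (measurable_subtype_coe.comp (measurable_coord i)).pow_const k

theorem integrable_coord_pow (i : Fin (d + 1)) (k : ℕ) :
    Integrable (fun x : RoundSphere d ↦ (coord i x : ℝ) ^ k) (uniformMeasure d) := by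
  refine Integrable.of_bound (C := 1) (measurable_coord_pow i k).aestronglyMeasurable
    (.of_forall fun x ↦ ?_)
  rw [norm_pow]
  exact pow_le_one₀ (norm_nonneg _) (abs_le.2 (coord i x).2)

theorem integral_coord_pow_odd (i : Fin (d + 1)) {k : ℕ} (hk : Odd k) :
    ∫ x, (coord i x : ℝ) ^ k ∂uniformMeasure d = 0 := by
  have hneg := integral_comp_of_measurePreserving
    (measurePreserving_isometryMap (d := d) (LinearIsometryEquiv.neg ℝ))
    (measurable_coord_pow i k).aestronglyMeasurable
  have hodd : ∀ x, (coord i (isometryMap (LinearIsometryEquiv.neg ℝ) x) : ℝ) ^ k =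
      -((coord i x : ℝ) ^ k) := fun x ↦ by
    rw [← hk.neg_pow]
    rfl
  simp_rw [hodd, integral_neg] at hneg
  linarith

theorem coord_zero_sq_add_coord_one_sq_le (x : RoundSphere (d + 1)) :
    (coord 0 x : ℝ) ^ 2 + (coord 1 x : ℝ) ^ 2 ≤ 1 := by
  have hnorm : ‖x.coords‖ ^ 2 = ∑ i, x.coords i ^ 2 := EuclideanSpace.real_norm_sq_eq _
  rw [norm_coords, one_pow] at hnorm
  calc (coord 0 x : ℝ) ^ 2 + (coord 1 x : ℝ) ^ 2
      = ∑ i ∈ {0, 1}, x.coords i ^ 2 :=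
          (Finset.sum_pair (f := fun i ↦ x.coords i ^ 2) zero_ne_one).symm
    _ ≤ ∑ i, x.coords i ^ 2 :=
        Finset.sum_le_univ_sum_of_nonneg fun i ↦ sq_nonneg _
    _ = 1 := hnorm.symm

theorem integral_coord_zero_sq_le :
    ∫ x, (coord 0 x : ℝ) ^ 2 ∂uniformMeasure (d + 1) ≤ 1 / 2 := by
  have hswap := integral_comp_of_measurePreserving (measurePreserving_swap (d := d))
    (measurable_coord_pow 0 2).aestronglyMeasurable
  simp_rw [coord_zero_swap] at hswap
  have hsum : ∫ x, ((coord 0 x : ℝ) ^ 2 + (coord 1 x : ℝ) ^ 2) ∂uniformMeasure (d + 1) ≤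
      ∫ _, 1 ∂uniformMeasure (d + 1) :=
    integral_mono ((integrable_coord_pow 0 2).add (integrable_coord_pow 1 2))
      (integrable_const _) coord_zero_sq_add_coord_one_sq_le
  rw [integral_add (integrable_coord_pow 0 2) (integrable_coord_pow 1 2), hswap,
    integral_const, probReal_univ, one_smul] at hsum
  linarith

theorem abs_integral_coord_zero_pow_le {k : ℕ} (hk : k ≠ 0) :
    |∫ x, (coord 0 x : ℝ) ^ k ∂uniformMeasure (d + 1)| ≤ 1 / 2 := by
  rcases Nat.even_or_odd k with heven | hodd
  · have h2 : 2 ≤ k := by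
      obtain ⟨j, rfl⟩ := heven
      omega
    rw [abs_of_nonneg (integral_nonneg fun x ↦ heven.pow_nonneg _)]
    refine (integral_mono (integrable_coord_pow 0 k) (integrable_coord_pow 0 2) fun x ↦ ?_).trans
      integral_coord_zero_sq_le
    simp only
    rw [← heven.pow_abs, ← even_two.pow_abs]
    exact pow_le_pow_of_le_one (abs_nonneg _) (abs_le.2 (coord 0 x).2) h2
  · rw [integral_coord_pow_odd 0 hodd, abs_zero]
    norm_num

theorem integral_comp_coord_zero_mul_coord_zero_swap_pow {F : Set.Icc (-1 : ℝ) 1 → ℝ}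
    (hF : AEStronglyMeasurable F (latitudeMeasure d)) (k : ℕ) :
    ∫ x, F (coord 0 x) * (coord 0 (swap x) : ℝ) ^ k ∂uniformMeasure (d + 1) =
      (∫ t, F t * √(1 - (t : ℝ) ^ 2) ^ k ∂latitudeMeasure d) *
        ∫ y, (coord 0 y : ℝ) ^ k ∂uniformMeasure d := by
  have hmeas : AEStronglyMeasurable
      (fun x ↦ F (coord 0 x) * (coord 0 (swap x) : ℝ) ^ k) (uniformMeasure (d + 1)) :=
    (hF.comp_measurePreserving (measurePreserving_coord_zero d)).mul
      ((measurable_coord_pow 0 k).comp measurePreserving_swap.measurable).aestronglyMeasurable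
  rw [← integral_comp_of_measurePreserving (measurePreserving_join d) hmeas, ← integral_prod_mul]
  refine integral_congr_ae (.of_forall fun ⟨t, y⟩ ↦ ?_)
  simp only [coord_zero_join, coord_zero_swap_join, mul_pow, mul_assoc]

theorem exists_one_sub_sq_pow_eq_add (j : ℕ) : ∃ q : ℝ[X],
    q.degree < (2 * j : ℕ) ∧ (1 - X ^ 2) ^ j = C ((-1) ^ j) * X ^ (2 * j) + q := by
  have hmonic : ((X ^ 2 - C 1 : ℝ[X]) ^ j).Monic := (monic_X_pow_sub_C 1 two_ne_zero).pow j
  have hdegree : ((X ^ 2 - C 1 : ℝ[X]) ^ j).degree = (2 * j : ℕ) := by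
    rw [degree_pow, degree_X_pow_sub_C two_pos, nsmul_eq_mul, mul_comm]
    norm_cast
  refine ⟨C ((-1) ^ j) * ((X ^ 2 - C 1) ^ j - X ^ (2 * j)), ?_, ?_⟩
  · rw [degree_C_mul (by simp), ← hdegree]
    exact degree_sub_lt_left (by rw [hdegree, degree_X_pow]) hmonic.ne_zero
      (by rw [hmonic.leadingCoeff, leadingCoeff_X_pow])
  · have hneg : (1 - X ^ 2 : ℝ[X]) = C (-1) * (X ^ 2 - C 1) := by simp
    rw [hneg, mul_pow, C_pow]
    ring

theorem exists_integral_comp_coord_zero_mul_eq (k : ℕ) : ∃ q : ℝ[X], q.degree < k ∧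
    ∀ F : Set.Icc (-1 : ℝ) 1 → ℝ, AEStronglyMeasurable F (latitudeMeasure d) →
      ∫ x, F (coord 0 x) * (coord 0 (swap x) : ℝ) ^ k ∂uniformMeasure (d + 1) =
        ∫ t, F t * ((-1) ^ (k / 2) * (∫ y, (coord 0 y : ℝ) ^ k ∂uniformMeasure d) * (t : ℝ) ^ k +
          q.eval (t : ℝ)) ∂latitudeMeasure d := by
  rcases Nat.even_or_odd' k with ⟨j, rfl | rfl⟩
  · obtain ⟨q, hq, hpow⟩ := exists_one_sub_sq_pow_eq_add j
    refine ⟨(∫ y, (coord 0 y : ℝ) ^ (2 * j) ∂uniformMeasure d) • q,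
      (degree_smul_le _ _).trans_lt hq, fun F hF ↦ ?_⟩
    rw [integral_comp_coord_zero_mul_coord_zero_swap_pow hF, ← integral_mul_const]
    refine integral_congr_ae (.of_forall fun t ↦ ?_)
    have ht : 0 ≤ 1 - (t : ℝ) ^ 2 := by nlinarith [t.2.1, t.2.2]
    have heval := congrArg (eval (t : ℝ)) hpow
    simp only [eval_pow, eval_sub, eval_one, eval_X, eval_add, eval_mul, eval_C] at heval
    simp only [pow_mul √_, Real.sq_sqrt ht, heval, Nat.mul_div_cancel_left j two_pos,
      eval_smul, smul_eq_mul]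
    ring
  · refine ⟨0, degree_zero.trans_lt (WithBot.bot_lt_coe _), fun F hF ↦ ?_⟩
    rw [integral_comp_coord_zero_mul_coord_zero_swap_pow hF,
      integral_coord_pow_odd 0 (odd_two_mul_add_one j)]
    simp

theorem maxCorrLE_coord_zero_swap (d : ℕ) :
    MaxCorrLE (coord 0) (coord 0 ∘ swap) (1 / 2) (uniformMeasure (d + 2)) := by
  have hcoord := measurePreserving_coord_zero (d + 1)
  refine maxCorrLE_of_triangular_moments
    (l := fun k ↦ (-1) ^ (k / 2) * ∫ y, (coord 0 y : ℝ) ^ k ∂uniformMeasure (d + 1))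
    hcoord (hcoord.comp measurePreserving_swap) measurePreserving_swap rfl ?_ (by norm_num)
    (fun k hk ↦ ?_) fun k ↦ ?_
  · rw [Function.comp_assoc, swap_involutive.comp_self, Function.comp_id]
  · rw [abs_mul, abs_neg_one_pow, one_mul]
    exact abs_integral_coord_zero_pow_le hk
  · obtain ⟨q, hq, h⟩ := exists_integral_comp_coord_zero_mul_eq (d := d + 1) k
    exact ⟨q, hq, fun F hF ↦ h F hF.1⟩

end Correlation

end RoundSphere

namespace RoundSphere

section Suspension

variable {d : ℕ}

theorem norm_coords_sub_le_dist (x y : RoundSphere d) : ‖x.coords - y.coords‖ ≤ dist x y := by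
  refine le_of_sq_le_sq ?_ dist_nonneg
  have := Real.one_sub_sq_div_two_le_cos (x := dist x y)
  rw [norm_coords_sub_sq]
  linarith

theorem dist_le_norm_coords_sub (x y : RoundSphere d) :
    dist x y ≤ Real.pi / 2 * ‖x.coords - y.coords‖ := by
  have hdist : |dist x y| ≤ Real.pi := by
    rw [abs_of_nonneg dist_nonneg]
    exact InnerProductGeometry.angle_le_pi _ _
  refine le_of_sq_le_sq ?_ (by positivity)
  calc dist x y ^ 2
      = (Real.pi / 2) ^ 2 * (2 - 2 * (1 - 2 / Real.pi ^ 2 * dist x y ^ 2)) := by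
        field_simp
        ring
    _ ≤ (Real.pi / 2) ^ 2 * (2 - 2 * Real.cos (dist x y)) := by
        gcongr
        exact Real.cos_le_one_sub_mul_cos_sq hdist
    _ = (Real.pi / 2 * ‖x.coords - y.coords‖) ^ 2 := by rw [mul_pow, norm_coords_sub_sq]

/-- The projection of `x ∈ ℝ^(d+2)` to `ℝ^(d+1)` that forgets the first coordinate. -/
def tailCoords (x : RoundSphere (d + 1)) : EuclideanSpace ℝ (Fin (d + 1)) :=
  WithLp.toLp 2 fun i ↦ x.coords i.succ

theorem measurable_tailCoords : Measurable (tailCoords (d := d)) := by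
  have htail : Continuous fun v : EuclideanSpace ℝ (Fin (d + 2)) ↦
      (WithLp.toLp 2 fun i : Fin (d + 1) ↦ v i.succ : EuclideanSpace ℝ (Fin (d + 1))) := by
    fun_prop
  exact htail.measurable.comp measurable_coords

theorem consVec_tailCoords (x : RoundSphere (d + 1)) :
    consVec (x.coords 0, tailCoords x) = x.coords := by
  ext i
  refine Fin.cases ?_ (fun j ↦ ?_) i <;> simp [consVec, tailCoords]

theorem norm_tailCoords (x : RoundSphere (d + 1)) : ‖tailCoords x‖ = √(1 - x.coords 0 ^ 2) := by
  have hnorm := norm_consVec_sq (x.coords 0, tailCoords x)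
  rw [consVec_tailCoords, norm_coords, one_pow] at hnorm
  rw [hnorm, add_sub_cancel_left, Real.sqrt_sq (norm_nonneg _)]

/-- The point of the equator on the meridian of a point of `S^(d+1)`; its value at the two poles is
immaterial. -/
noncomputable def equator (x : RoundSphere (d + 1)) : RoundSphere d :=
  radialProjection (tailCoords x)

theorem join_coord_zero_equator (x : RoundSphere (d + 1)) : join (coord 0 x, equator x) = x := by
  apply coords_injective
  change consVec (x.coords 0, √(1 - x.coords 0 ^ 2) • (equator x).coords) = x.coords
  rw [← norm_tailCoords, equator, norm_smul_coords_radialProjection, consVec_tailCoords]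

/-- The suspension of a self-map of the equator `S^d`: it acts by `φ` on every parallel of
`S^(d+1)`. -/
noncomputable def suspend (φ : RoundSphere d → RoundSphere d) (x : RoundSphere (d + 1)) :
    RoundSphere (d + 1) :=
  join (coord 0 x, φ (equator x))

theorem suspend_join (φ : RoundSphere d → RoundSphere d) (t : Set.Icc (-1 : ℝ) 1)
    (y : RoundSphere d) : suspend φ (join (t, y)) = join (t, φ y) := by
  have hequator : equator (join (t, y)) = radialProjection (√(1 - (t : ℝ) ^ 2) • y.coords) := rfl
  rw [suspend, coord_zero_join, hequator]
  rcases (Real.sqrt_nonneg (1 - (t : ℝ) ^ 2)).eq_or_lt with hpole | hpos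
  · apply coords_injective
    simp [join, ← hpole]
  · rw [radialProjection_smul_coords hpos]

theorem suspend_suspend (φ ψ : RoundSphere d → RoundSphere d) (x : RoundSphere (d + 1)) :
    suspend φ (suspend ψ x) = suspend (φ ∘ ψ) x :=
  suspend_join φ _ _

theorem suspend_id (x : RoundSphere (d + 1)) : suspend id x = x := join_coord_zero_equator x

theorem measurePreserving_suspend {φ : RoundSphere d → RoundSphere d}
    (hφ : MeasurePreserving φ (uniformMeasure d) (uniformMeasure d)) :
    MeasurePreserving (suspend φ) (uniformMeasure (d + 1)) (uniformMeasure (d + 1)) := by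
  have hequator : Measurable (equator (d := d)) :=
    measurable_radialProjection.comp measurable_tailCoords
  exact (measurePreserving_join d).of_semiconj ((MeasurePreserving.id _).prod hφ)
    (fun p ↦ (suspend_join φ p.1 p.2).symm)
    (measurable_join.comp ((measurable_coord 0).prodMk (hφ.measurable.comp hequator)))

theorem norm_join_sub_sq (p q : Set.Icc (-1 : ℝ) 1 × RoundSphere d) :
    ‖(join p).coords - (join q).coords‖ ^ 2 = ((p.1 : ℝ) - q.1) ^ 2 +
      ((√(1 - (p.1 : ℝ) ^ 2) - √(1 - (q.1 : ℝ) ^ 2)) ^ 2 +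
        √(1 - (p.1 : ℝ) ^ 2) * √(1 - (q.1 : ℝ) ^ 2) * ‖p.2.coords - q.2.coords‖ ^ 2) := by
  simp only [join, coords_ofCoords]
  rw [consVec_sub, norm_consVec_sq, Prod.snd_sub, @norm_sub_sq_real, @norm_sub_sq_real, norm_smul,
    norm_smul, norm_coords, norm_coords, inner_smul_left, inner_smul_right,
    Real.norm_of_nonneg (Real.sqrt_nonneg _), Real.norm_of_nonneg (Real.sqrt_nonneg _)]
  simp only [Prod.fst_sub, conj_trivial]
  ring

theorem norm_suspend_sub_le {φ : RoundSphere d → RoundSphere d} {L : ℝ} (hL : 1 ≤ L)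
    (hφ : ∀ y y', ‖(φ y).coords - (φ y').coords‖ ≤ L * ‖y.coords - y'.coords‖)
    (x x' : RoundSphere (d + 1)) :
    ‖(suspend φ x).coords - (suspend φ x').coords‖ ≤ L * ‖x.coords - x'.coords‖ := by
  refine le_of_sq_le_sq ?_ (by positivity)
  conv_rhs => rw [mul_pow, ← join_coord_zero_equator x, ← join_coord_zero_equator x']
  rw [suspend, suspend, norm_join_sub_sq, norm_join_sub_sq, mul_add, mul_add]
  have hL2 : 1 ≤ L ^ 2 := one_le_pow₀ hL
  refine add_le_add (le_mul_of_one_le_left (sq_nonneg _) hL2)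
    (add_le_add (le_mul_of_one_le_left (sq_nonneg _) hL2) ?_)
  rw [mul_left_comm, ← mul_pow]
  gcongr
  exact hφ _ _

/-- The Lipschitz constant, for the geodesic metric, that passing to the chordal metric and back
gives for the suspension of a `K`-Lipschitz map. -/
noncomputable def suspensionConstant (K : ℝ≥0) : ℝ≥0 :=
  (Real.pi / 2).toNNReal * (1 + K * (Real.pi / 2).toNNReal)

theorem lipschitzWith_suspend {φ : RoundSphere d → RoundSphere d} {K : ℝ≥0}
    (hφ : LipschitzWith K φ) : LipschitzWith (suspensionConstant K) (suspend φ) := by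
  refine LipschitzWith.of_dist_le_mul fun x x' ↦ ?_
  have hchord (y y' : RoundSphere d) :
      ‖(φ y).coords - (φ y').coords‖ ≤ (1 + K * (Real.pi / 2)) * ‖y.coords - y'.coords‖ := by
    calc _ ≤ dist (φ y) (φ y') := norm_coords_sub_le_dist _ _
      _ ≤ K * dist y y' := hφ.dist_le_mul _ _
      _ ≤ K * (Real.pi / 2 * ‖y.coords - y'.coords‖) := by
          gcongr
          exact dist_le_norm_coords_sub _ _
      _ = K * (Real.pi / 2) * ‖y.coords - y'.coords‖ := by ring
      _ ≤ _ := by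
          gcongr
          exact le_add_of_nonneg_left zero_le_one
  calc _ ≤ Real.pi / 2 * ‖(suspend φ x).coords - (suspend φ x').coords‖ :=
        dist_le_norm_coords_sub _ _
    _ ≤ Real.pi / 2 * ((1 + K * (Real.pi / 2)) * dist x x') := by
        gcongr
        refine (norm_suspend_sub_le ?_ hchord x x').trans ?_
        · exact le_add_of_nonneg_right (by positivity)
        · gcongr
          exact norm_coords_sub_le_dist _ _
    _ = suspensionConstant K * dist x x' := by
        rw [suspensionConstant]
        push_cast
        rw [Real.coe_toNNReal _ (by positivity), mul_assoc]

/-- The suspension of a measure-preserving bijection. -/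
noncomputable def suspension (φ : MeasurePreservingBijection (uniformMeasure d)) :
    MeasurePreservingBijection (uniformMeasure (d + 1)) :=
  ⟨⟨suspend φ.1, suspend φ.1.symm,
    fun x ↦ by rw [suspend_suspend, Equiv.symm_comp_self, suspend_id],
    fun x ↦ by rw [suspend_suspend, Equiv.self_comp_symm, suspend_id]⟩,
    measurePreserving_suspend φ.2⟩

end Suspension

end RoundSphere

theorem mainTheorem7 (m : ℕ) (hm : 3 ≤ m)
    (h : ExpandsUniformly (RoundSphere (m - 1)) (RoundSphere.uniformMeasure (m - 1))) :
    ExpandsUniformly (RoundSphere m) (RoundSphere.uniformMeasure m) := by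
  obtain ⟨d, rfl⟩ : ∃ d, m = d + 2 := ⟨m - 2, by omega⟩
  exact ExpandsUniformly.of_join (lift := RoundSphere.suspension)
    (RoundSphere.measurePreserving_join (d + 1)) (RoundSphere.measurable_coord 0)
    RoundSphere.coord_zero_join (fun φ ↦ RoundSphere.suspend_join φ.1)
    (fun K φ hφ ↦ ⟨RoundSphere.lipschitzWith_suspend hφ.1, RoundSphere.lipschitzWith_suspend hφ.2⟩)
    RoundSphere.measurePreserving_swap RoundSphere.swap_involutive RoundSphere.isometry_swap
    (by norm_num) (by norm_num) (RoundSphere.maxCorrLE_coord_zero_swap d) h
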